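/- Let $p\ge 1$, let $g$ be a $\mathbb C$-algebra automorphism of $\mathbb C[t]$ of order $p$ with $g(t)=\xi t$ for some $\xi\in\mathbb C$, and let $D=(c_1t+c_{p+1}t^{p+1})\frac{d}{dt}$ with $c_1,c_{p+1}\in\mathbb C$. For a commutative associative unital $\mathbb C$-algebra $A$ with a derivation $\partial$, write $(A,\partial)$ also for the vertex algebra on $A$ with vacuum $1$ and $Y(a,x)b=\sum_{i\ge 0}\frac1{i!}(\partial^i a)\,b\,x^i$. An $(A,\partial)$-module $(M,Y_M)$ as a vertex algebra is said to come from an $A$-module as an associative algebra if $M$ has an $A$-module structure with $Y_M(a,x)w=\sum_{i\ge 0}\frac1{i!}(\partial^i a)w\,x^i$ for all $a\in A$, $w\in M$. In a $g$-twisted $(\mathbb C[t],D)$-module $(W,Y_W)$ the convention is that $Y_W(u,x)=\sum_{i\in r/p+\mathbb Z}u_ix^{-i-1}$ if $gu=\xi^r u$. Then the following hold. (1) $gD=Dg$, so $g$ is an automorphism of the vertex algebra $(\mathbb C[t],D)$. The fixed-point subalgebra $\{a\in\mathbb C[t] : ga=a\}$ equals $\mathbb C[t^p]$. It is stable under $D$,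 and $(\mathbb C[t^p],D)$ is a vertex subalgebra of $(\mathbb C[t],D)$. (2) $(\mathbb C[t^p],D)\cong\bigl(\mathbb C[t],(pc_1t+pc_{p+1}t^2)\frac{d}{dt}\bigr)$ as associative algebras with derivations, and hence as vertex algebras. (3) Let $M$ be a finite-dimensional indecomposable $(\mathbb C[t^p],D)$-module as a vertex algebra. (a) If $M$ does not come from a $\mathbb C[t^p]$-module as an associative algebra, then $M$ is isomorphic to the restriction to $\mathbb C[t^p]$ of some finite-dimensional indecomposable $g$-twisted $(\mathbb C[t],D)$-module. (b) If $M$ comes from a $\mathbb C[t^p]$-module as an associative algebra, then $M$ is contained in (that is, isomorphic to a $(\mathbb C[t^p],D)$-submodule of) some finite-dimensional indecomposable (untwisted) $(\mathbb C[t],D)$-module which comes from a $\mathbb C[t]$-module as an associative algebra. (c) Consequently, every finite-dimensional indecomposable $(\mathbb C[t^p],D)$-module as a vertex algebra is contained in some finite-dimensional indecomposable untwisted or $g$-twisted $(\mathbb C[t],D)$-module. -/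

import Mathlib

open scoped Polynomial

universe u

/-! ### Vertex algebras and their twisted modules -/

section Basic

/-- A vertex algebra over `ℂ`. The operator `mode n u` is the coefficient `u_n` in
`Y(u, x) = ∑ u_n x^(-n-1)`. All the sums in the Borcherds identity have only finitely many nonzero
terms, by the truncation condition. -/
structure VertexAlgebra (V : Type*) [AddCommGroup V] [Module ℂ V] where
  /-- the vacuum vector -/
  vac : V
  /-- `mode n u v = u_n v` -/
  mode : ℤ → V →ₗ[ℂ] V →ₗ[ℂ] V
  truncation : ∀ u v : V, ∃ N : ℤ, ∀ n : ℤ, N ≤ n → mode n u v = 0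
  vacuum : ∀ (n : ℤ) (v : V), mode n vac v = if n = -1 then v else 0
  creation : ∀ u : V, mode (-1) u vac = u
  creation_nonneg : ∀ (n : ℤ) (u : V), 0 ≤ n → mode n u vac = 0
  borcherds : ∀ (l m n : ℤ) (u v w : V),
    ∑ᶠ i : ℕ, Ring.choose (m : ℂ) i • mode (m + n - i) (mode (l + i) u v) w =
      ∑ᶠ i : ℕ, ((-1 : ℂ) ^ i * Ring.choose (l : ℂ) i) •
        (mode (l + m - i) u (mode (n + i) v w) +
          (-1 : ℂ) ^ (l + 1) • mode (l + n - i) v (mode (m + i) u w))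

/-- `f` is a homomorphism of vertex algebras. -/
def VertexAlgebra.IsHom {V W : Type*} [AddCommGroup V] [Module ℂ V] [AddCommGroup W] [Module ℂ W]
    (𝒱 : VertexAlgebra V) (𝒲 : VertexAlgebra W) (f : V →ₗ[ℂ] W) : Prop :=
  f 𝒱.vac = 𝒲.vac ∧ ∀ (n : ℤ) (u v : V), f (𝒱.mode n u v) = 𝒲.mode n (f u) (f v)

/-- A `g`-twisted module `M` for a vertex algebra `V`, where `g` is an automorphism of `V` with
`g ^ p = 1` and `ζ` is a primitive `p`-th root of unity, so that `V` is the direct sum of the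
eigenspaces `V^r = {u | g u = ζ ^ r u}`. The operator `mode k u` is the coefficient `u_{k/p}` in
`Y_M(u, x) = ∑_{i ∈ (1/p)ℤ} u_i x^(-i-1)`, that is, modes are indexed by their numerators. All the
sums in the twisted Borcherds identity have only finitely many nonzero terms, by the truncation
conditions. -/
structure TwistedModule {V : Type*} [AddCommGroup V] [Module ℂ V] (𝒱 : VertexAlgebra V)
    (g : V →ₗ[ℂ] V) (p : ℕ) (ζ : ℂ) (M : Type*) [AddCommGroup M] [Module ℂ M] where
  /-- `mode k u w = u_{k/p} w` -/
  mode : ℤ → V →ₗ[ℂ] M →ₗ[ℂ] M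
  grading : ∀ (r : ℕ) (u : V), g u = ζ ^ r • u → ∀ k : ℤ, ¬ k ≡ r [ZMOD p] → mode k u = 0
  truncation : ∀ (u : V) (w : M), ∃ N : ℤ, ∀ k : ℤ, N ≤ k → mode k u w = 0
  vacuum : ∀ (k : ℤ) (w : M), mode k 𝒱.vac w = if k = -p then w else 0
  /-- the twisted Borcherds identity for the indices `l`, `m / p` and `n / p` -/
  borcherds : ∀ (r s : ℕ) (u v : V), g u = ζ ^ r • u → g v = ζ ^ s • v →
    ∀ l m n : ℤ, m ≡ r [ZMOD p] → n ≡ s [ZMOD p] → ∀ w : M,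
    ∑ᶠ i : ℕ, Ring.choose ((m : ℂ) / p) i • mode (m + n - p * i) (𝒱.mode (l + i) u v) w =
      ∑ᶠ i : ℕ, ((-1 : ℂ) ^ i * Ring.choose (l : ℂ) i) •
        (mode (p * l + m - p * i) u (mode (n + p * i) v w) +
          (-1 : ℂ) ^ (l + 1) • mode (p * l + n - p * i) v (mode (m + p * i) u w))

/-- An (untwisted) module for a vertex algebra. Here `mode k u` is `u_k`. -/
abbrev UntwistedModule {V : Type*} [AddCommGroup V] [Module ℂ V] (𝒱 : VertexAlgebra V)
    (M : Type*) [AddCommGroup M] [Module ℂ M] :=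
  TwistedModule 𝒱 LinearMap.id 1 1 M

/-- A submodule: a subspace stable under all the modes. -/
def TwistedModule.IsSubmodule {V : Type*} [AddCommGroup V] [Module ℂ V] {𝒱 : VertexAlgebra V}
    {g : V →ₗ[ℂ] V} {p : ℕ} {ζ : ℂ} {M : Type*} [AddCommGroup M] [Module ℂ M]
    (Y : TwistedModule 𝒱 g p ζ M) (N : Submodule ℂ M) : Prop :=
  ∀ (k : ℤ) (u : V), ∀ w ∈ N, Y.mode k u w ∈ N

/-- A module is indecomposable if it is nonzero and is not a direct sum of two nonzero
submodules. -/
def TwistedModule.IsIndecomposable {V : Type*} [AddCommGroup V] [Module ℂ V]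
    {𝒱 : VertexAlgebra V} {g : V →ₗ[ℂ] V} {p : ℕ} {ζ : ℂ} {M : Type*} [AddCommGroup M]
    [Module ℂ M] (Y : TwistedModule 𝒱 g p ζ M) : Prop :=
  Nontrivial M ∧ ∀ N₁ N₂ : Submodule ℂ M, Y.IsSubmodule N₁ → Y.IsSubmodule N₂ →
    IsCompl N₁ N₂ → N₁ = ⊥ ∨ N₂ = ⊥

/-- Let `ι : U → V` be a homomorphism of vertex algebras (in practice, the inclusion of a
subalgebra fixed by `g`), `N` a `U`-module and `W` a `g`-twisted `V`-module. The linear map `φ` is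
a homomorphism of `U`-modules from `N` to the restriction of `W`, that is,
`Y_W(ι a, x) φ(w) = φ(Y_N(a, x) w)`; on the left the coefficients `(ι a)_{k/p}` with `k/p` not an
integer have to vanish on `φ(w)`. -/
def IsRestrictionHom {U V : Type*} [AddCommGroup U] [Module ℂ U] [AddCommGroup V] [Module ℂ V]
    {𝒰 : VertexAlgebra U} {𝒱 : VertexAlgebra V} {g : V →ₗ[ℂ] V} {p : ℕ} {ζ : ℂ}
    {N W : Type*} [AddCommGroup N] [Module ℂ N] [AddCommGroup W] [Module ℂ W]
    (ι : U →ₗ[ℂ] V) (YN : UntwistedModule 𝒰 N) (YW : TwistedModule 𝒱 g p ζ W)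
    (φ : N →ₗ[ℂ] W) : Prop :=
  ∀ (a : U) (w : N),
    (∀ k : ℤ, YW.mode (p * k) (ι a) (φ w) = φ (YN.mode k a w)) ∧
    (∀ k : ℤ, ¬ (p : ℤ) ∣ k → YW.mode k (ι a) (φ w) = 0)

end Basic

/-! ### The vertex algebra of a commutative algebra with a derivation -/

section CommutativeAlgebra

open Finset

/-- The divided power `D ^ k / k!` of a derivation. -/
noncomputable def divPow {A : Type*} [CommRing A] [Algebra ℂ A] (D : Derivation ℂ A A) (k : ℕ) :
    A →ₗ[ℂ] A :=
  ((k.factorial : ℂ)⁻¹) • ((D : A →ₗ[ℂ] A) ^ k)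

theorem pow_leibniz {A : Type*} [CommRing A] [Algebra ℂ A] (D : Derivation ℂ A A) (n : ℕ)
    (a b : A) : ((D : A →ₗ[ℂ] A) ^ n) (a * b) =
      ∑ ij ∈ antidiagonal n, n.choose ij.1 •
        (((D : A →ₗ[ℂ] A) ^ ij.1) a * ((D : A →ₗ[ℂ] A) ^ ij.2) b) := by
  induction n with
  | zero => simp
  | succ n ih =>
    rw [Finset.sum_antidiagonal_choose_succ_nsmul
      (fun i j => ((D : A →ₗ[ℂ] A) ^ i) a * ((D : A →ₗ[ℂ] A) ^ j) b), pow_succ',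
      Module.End.mul_apply, ih, map_sum, ← Finset.sum_add_distrib]
    refine Finset.sum_congr rfl fun ij hij => ?_
    have h : n.choose ij.2 = n.choose ij.1 := by
      rw [HasAntidiagonal.mem_antidiagonal] at hij
      rw [← hij]; exact Nat.choose_symm_add.symm
    rw [map_nsmul, h, ← smul_add, pow_succ' _ ij.1, pow_succ' _ ij.2]
    simp only [Module.End.mul_apply, Derivation.coeFn_coe, Derivation.leibniz, smul_eq_mul]
    congr 1
    ring

theorem divPow_mul {A : Type*} [CommRing A] [Algebra ℂ A] (D : Derivation ℂ A A) (n : ℕ)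
    (a b : A) : divPow D n (a * b) =
      ∑ ij ∈ antidiagonal n, divPow D ij.1 a * divPow D ij.2 b := by
  simp only [divPow, LinearMap.smul_apply, pow_leibniz, Finset.smul_sum]
  refine Finset.sum_congr rfl fun ij hij => ?_
  rw [HasAntidiagonal.mem_antidiagonal] at hij
  rw [smul_mul_smul_comm, ← Nat.cast_smul_eq_nsmul ℂ, smul_smul]
  congr 1
  have h := Nat.add_choose_mul_factorial_mul_factorial ij.1 ij.2
  rw [hij, ← show n.choose ij.1 = n.choose ij.2 from by
    rw [← hij]; exact Nat.choose_symm_add] at h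
  have h1 : (ij.1.factorial : ℂ) ≠ 0 := by exact_mod_cast Nat.factorial_ne_zero _
  have h2 : (ij.2.factorial : ℂ) ≠ 0 := by exact_mod_cast Nat.factorial_ne_zero _
  have h3 : (n.factorial : ℂ) ≠ 0 := by exact_mod_cast Nat.factorial_ne_zero _
  field_simp
  exact_mod_cast h

theorem divPow_divPow {A : Type*} [CommRing A] [Algebra ℂ A] (D : Derivation ℂ A A) (i j : ℕ)
    (a : A) : divPow D i (divPow D j a) = ((i + j).choose j : ℂ) • divPow D (i + j) a := by
  simp only [divPow, LinearMap.smul_apply, map_smul, smul_smul, pow_add, Module.End.mul_apply]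
  congr 1
  have h := Nat.add_choose_mul_factorial_mul_factorial i j
  have h1 : (i.factorial : ℂ) ≠ 0 := by exact_mod_cast Nat.factorial_ne_zero _
  have h2 : (j.factorial : ℂ) ≠ 0 := by exact_mod_cast Nat.factorial_ne_zero _
  have h3 : ((i+j).factorial : ℂ) ≠ 0 := by exact_mod_cast Nat.factorial_ne_zero _
  field_simp
  rw [← h]
  push_cast
  ring

/-- `D ^ j / j!` for an integer `j`, zero for negative `j`. -/
noncomputable def divPowZ {A : Type*} [CommRing A] [Algebra ℂ A] (D : Derivation ℂ A A) (j : ℤ) :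
    A →ₗ[ℂ] A :=
  if 0 ≤ j then divPow D j.toNat else 0

theorem divPowZ_natCast {A : Type*} [CommRing A] [Algebra ℂ A] (D : Derivation ℂ A A) (j : ℕ) :
    divPowZ D (j : ℤ) = divPow D j := by simp [divPowZ]

theorem divPowZ_neg {A : Type*} [CommRing A] [Algebra ℂ A] (D : Derivation ℂ A A) {j : ℤ}
    (h : j < 0) : divPowZ D j = 0 := by simp [divPowZ, h]

theorem divPowZ_mul_divPow {A : Type*} [CommRing A] [Algebra ℂ A] (D : Derivation ℂ A A)
    (P j : ℕ) (a b : A) : divPowZ D ((P : ℤ) - j) (divPow D j a * b) =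
      ∑ ij ∈ antidiagonal P, (ij.1.choose j : ℂ) • (divPow D ij.1 a * divPow D ij.2 b) := by
  rcases lt_or_ge P j with h | h
  · rw [divPowZ_neg D (by omega), LinearMap.zero_apply]
    refine (Finset.sum_eq_zero fun ij hij => ?_).symm
    rw [HasAntidiagonal.mem_antidiagonal] at hij
    rw [Nat.choose_eq_zero_of_lt (by omega)]; simp
  · obtain ⟨N, rfl⟩ := Nat.exists_eq_add_of_le' h
    rw [show ((N + j : ℕ) : ℤ) - j = N by push_cast; ring, divPowZ_natCast, divPow_mul]
    simp only [divPow_divPow, smul_mul_assoc]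
    refine Finset.sum_of_injOn (fun ij => (ij.1 + j, ij.2)) ?_ ?_ ?_ ?_
    · rintro ⟨a, b⟩ _ ⟨c, d⟩ _ h; simp at h ⊢; exact h
    · rintro ⟨a, b⟩ h; simp at h ⊢; omega
    · rintro ⟨a, b⟩ h h'
      simp only [HasAntidiagonal.mem_antidiagonal] at h
      have : a < j := by
        by_contra hc
        apply h'
        refine ⟨(a - j, b), ?_, ?_⟩
        · simp; omega
        · simp; omega
      rw [Nat.choose_eq_zero_of_lt this]; simp
    · intros; rfl

theorem divPowZ_mul_divPowZ {A : Type*} [CommRing A] [Algebra ℂ A] (D : Derivation ℂ A A)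
    (P : ℕ) (x y : ℤ) (h : x + y = P) (a b : A) : divPowZ D x a * divPowZ D y b =
      ∑ ij ∈ antidiagonal P, (if (ij.1 : ℤ) = x then (1 : ℂ) else 0) •
        (divPow D ij.1 a * divPow D ij.2 b) := by
  by_cases hx : 0 ≤ x ∧ 0 ≤ y
  · obtain ⟨hx, hy⟩ := hx
    lift x to ℕ using hx
    lift y to ℕ using hy
    rw [divPowZ_natCast, divPowZ_natCast, Finset.sum_eq_single (x, y)]
    · simp
    · rintro ⟨c, d⟩ hcd hne
      simp only [HasAntidiagonal.mem_antidiagonal] at hcd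
      rw [if_neg, zero_smul]
      intro h'; apply hne
      simp only at h'
      ext <;> simp <;> omega
    · intro h'; exfalso; apply h'; simp; omega
  · rw [Finset.sum_eq_zero]
    · rcases lt_or_ge x 0 with hx' | hx'
      · simp [divPowZ_neg D hx']
      · simp [divPowZ_neg D (show y < 0 by omega)]
    · rintro ⟨c, d⟩ hcd
      simp only [HasAntidiagonal.mem_antidiagonal] at hcd
      rw [if_neg, zero_smul]
      simp only; omega

theorem ring_choose_neg_succ (k i : ℕ) :
    (-1 : ℂ) ^ i * Ring.choose ((-(k + 1 : ℕ) : ℤ) : ℂ) i = ((k + i).choose k : ℂ) := by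
  push_cast
  rw [Ring.choose_neg, show ((k : ℂ) + 1 + i - 1) = ((k + i : ℕ) : ℂ) by push_cast; ring,
    Ring.choose_natCast, Int.negOnePow_def, Units.smul_def, ← Nat.choose_symm_add]
  simp [zsmul_eq_mul, ← mul_assoc, ← pow_add, ← two_mul]

theorem ring_choose_int_cases (k : ℕ) (q : ℤ) (N : ℕ) (hN : q.natAbs < N) :
    ∑ i ∈ range N, (((k + i).choose k : ℂ) * (if q = k + i then 1 else 0) +
      (-1 : ℂ) ^ k * ((k + i).choose k : ℂ) * (if q = -1 - i then 1 else 0)) =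
      Ring.choose (q : ℂ) k := by
  rcases lt_or_ge q 0 with h | h
  · obtain ⟨j, hj⟩ : ∃ j : ℕ, q = -(j + 1 : ℕ) := ⟨q.natAbs - 1, by omega⟩
    rw [Finset.sum_eq_single j]
    · rw [if_neg (by omega), if_pos (by omega), mul_zero, zero_add, mul_one]
      have h1 := ring_choose_neg_succ j k
      rw [← hj] at h1
      rw [show (k + j).choose k = (j + k).choose j by
        rw [add_comm j k]; exact Nat.choose_symm_add, ← h1, ← mul_assoc, ← pow_add, ← two_mul]
      simp
    · intro i _ hi
      rw [if_neg (by omega), if_neg (by omega)]; simp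
    · intro hj'; exfalso; apply hj'; rw [mem_range]; omega
  · lift q to ℕ using h
    rw [Int.cast_natCast, Ring.choose_natCast]
    rcases lt_or_ge q k with hk | hk
    · rw [Nat.choose_eq_zero_of_lt hk, Finset.sum_eq_zero, Nat.cast_zero]
      intro i _
      rw [if_neg (by omega), if_neg (by omega)]; simp
    · rw [Finset.sum_eq_single (q - k)]
      · rw [if_pos (by omega), if_neg (by omega), Nat.add_sub_cancel' hk]; simp
      · intro i _ hi
        rw [if_neg (by omega), if_neg (by omega)]; simp
      · intro hj'; exfalso; apply hj'; rw [mem_range]; omega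

theorem comm_borcherds {A : Type*} [CommRing A] [Algebra ℂ A] (D : Derivation ℂ A A)
    (l m n : ℤ) (u v w : A) :
    ∑ᶠ i : ℕ, Ring.choose (m : ℂ) i •
        (divPowZ D (-(m + n - i) - 1) (divPowZ D (-(l + i) - 1) u * v) * w) =
      ∑ᶠ i : ℕ, ((-1 : ℂ) ^ i * Ring.choose (l : ℂ) i) •
        (divPowZ D (-(l + m - i) - 1) u * (divPowZ D (-(n + i) - 1) v * w) +
          (-1 : ℂ) ^ (l + 1) •
            (divPowZ D (-(l + n - i) - 1) v * (divPowZ D (-(m + i) - 1) u * w))) := by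
  rcases lt_or_ge l 0 with hl | hl
  · obtain ⟨k, hk⟩ : ∃ k : ℕ, l = -(k + 1 : ℕ) := ⟨l.natAbs - 1, by omega⟩
    have hsign : (-1 : ℂ) ^ (l + 1) = (-1) ^ k := by
      rw [hk, show (-((k + 1 : ℕ) : ℤ) + 1) = -(k : ℤ) by push_cast; ring, zpow_neg, zpow_natCast,
        ← inv_pow]; norm_num
    simp only [hsign]
    subst hk
    simp only [ring_choose_neg_succ]
    rw [finsum_eq_sum_of_support_subset (s := range (k + 1))]
    swap
    · intro i hi
      rw [Function.mem_support] at hi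
      rw [coe_range, Set.mem_Iio]
      by_contra hc
      apply hi
      rw [divPowZ_neg D (j := -(-((k + 1 : ℕ) : ℤ) + i) - 1) (by push_cast; omega)]
      simp
    rcases lt_or_ge ((k : ℤ) - m - n - 1) 0 with hP | hP
    · rw [Finset.sum_eq_zero, finsum_eq_zero_of_forall_eq_zero]
      · intro i
        have h1 : divPowZ D (-(-((k + 1 : ℕ) : ℤ) + m - i) - 1) u *
            (divPowZ D (-(n + i) - 1) v * w) = 0 := by
          rcases lt_or_ge (-(n + (i : ℤ)) - 1) 0 with h | h
          · rw [divPowZ_neg D h]; simp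
          · rw [divPowZ_neg D (j := -(-((k + 1 : ℕ) : ℤ) + m - i) - 1) (by push_cast; omega)]; simp
        have h2 : divPowZ D (-(-((k + 1 : ℕ) : ℤ) + n - i) - 1) v *
            (divPowZ D (-(m + i) - 1) u * w) = 0 := by
          rcases lt_or_ge (-(m + (i : ℤ)) - 1) 0 with h | h
          · rw [divPowZ_neg D h]; simp
          · rw [divPowZ_neg D (j := -(-((k + 1 : ℕ) : ℤ) + n - i) - 1) (by push_cast; omega)]; simp
        rw [h1, h2]; simp
      · intro i hi
        rw [mem_range] at hi
        rw [divPowZ_neg D (j := -(m + n - i) - 1) (by omega)]; simp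
    · obtain ⟨P, hP'⟩ := Int.eq_ofNat_of_zero_le hP
      have hL : ∑ i ∈ range (k + 1), Ring.choose (m : ℂ) i •
          (divPowZ D (-(m + n - i) - 1) (divPowZ D (-(-((k + 1 : ℕ) : ℤ) + i) - 1) u * v) * w) =
          ∑ ij ∈ antidiagonal P, Ring.choose ((m + ij.1 : ℤ) : ℂ) k •
            (divPow D ij.1 u * divPow D ij.2 v * w) := by
        have : ∀ i ∈ range (k + 1), Ring.choose (m : ℂ) i •
          (divPowZ D (-(m + n - i) - 1) (divPowZ D (-(-((k + 1 : ℕ) : ℤ) + i) - 1) u * v) * w) =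
          ∑ ij ∈ antidiagonal P, (Ring.choose (m : ℂ) i * (ij.1.choose (k - i) : ℂ)) •
            (divPow D ij.1 u * divPow D ij.2 v * w) := by
          intro i hi
          rw [mem_range] at hi
          rw [show -(m + n - i) - 1 = (P : ℤ) - (k - i : ℕ) by omega,
            show -(-((k + 1 : ℕ) : ℤ) + i) - 1 = (k - i : ℕ) by omega, divPowZ_natCast,
            divPowZ_mul_divPow, Finset.sum_mul, Finset.smul_sum]
          simp only [smul_mul_assoc, smul_smul]
        rw [Finset.sum_congr rfl this, Finset.sum_comm]
        refine Finset.sum_congr rfl fun ij _ => ?_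
        rw [← Finset.sum_smul]
        congr 1
        push_cast
        rw [Ring.add_choose_eq k (Commute.all _ _), Nat.sum_antidiagonal_eq_sum_range_succ_mk]
        simp only [Ring.choose_natCast]
      rw [hL]
      set N := k + P + m.natAbs + n.natAbs + 2 with hN
      rw [finsum_eq_sum_of_support_subset (s := range N)]
      swap
      · intro i hi
        rw [Function.mem_support] at hi
        rw [coe_range, Set.mem_Iio]
        by_contra hc
        apply hi
        rw [divPowZ_neg D (j := -(n + (i : ℤ)) - 1) (by omega),
          divPowZ_neg D (j := -(m + (i : ℤ)) - 1) (by omega)]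
        simp
      have hR : ∀ i ∈ range N, ((k + i).choose k : ℂ) •
        (divPowZ D (-(-((k + 1 : ℕ) : ℤ) + m - i) - 1) u * (divPowZ D (-(n + i) - 1) v * w) +
          (-1 : ℂ) ^ k • (divPowZ D (-(-((k + 1 : ℕ) : ℤ) + n - i) - 1) v *
            (divPowZ D (-(m + i) - 1) u * w))) =
          ∑ ij ∈ antidiagonal P,
            (((k + i).choose k : ℂ) * (if (m + ij.1 : ℤ) = k + i then 1 else 0) +
              (-1 : ℂ) ^ k * ((k + i).choose k : ℂ) * (if (m + ij.1 : ℤ) = -1 - i then 1 else 0)) •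
            (divPow D ij.1 u * divPow D ij.2 v * w) := by
        intro i _
        rw [← mul_assoc, mul_left_comm (divPowZ D (-(-((k + 1 : ℕ) : ℤ) + n - i) - 1) v),
          ← mul_assoc (divPowZ D (-(m + i) - 1) u),
          divPowZ_mul_divPowZ D P _ _ (by push_cast; omega),
          divPowZ_mul_divPowZ D P _ _ (by push_cast; omega), Finset.sum_mul, Finset.sum_mul,
          Finset.smul_sum, ← Finset.sum_add_distrib, Finset.smul_sum]
        refine Finset.sum_congr rfl fun ij _ => ?_
        rw [smul_mul_assoc, smul_mul_assoc, smul_smul, ← add_smul, smul_smul]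
        congr 1
        have e1 : ((ij.1 : ℤ) = -(-((k + 1 : ℕ) : ℤ) + m - i) - 1) ↔ (m + ij.1 : ℤ) = k + i := by
          push_cast; omega
        have e2 : ((ij.1 : ℤ) = -(m + i) - 1) ↔ (m + ij.1 : ℤ) = -1 - i := by omega
        simp only [e1, e2]
        ring
      rw [Finset.sum_congr rfl hR, Finset.sum_comm]
      refine Finset.sum_congr rfl fun ij hij => ?_
      rw [HasAntidiagonal.mem_antidiagonal] at hij
      rw [← Finset.sum_smul, ring_choose_int_cases k (m + ij.1) N (by omega)]
  · lift l to ℕ using hl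
    rw [finsum_eq_zero_of_forall_eq_zero]
    swap
    · intro i
      rw [divPowZ_neg D (j := -((l : ℤ) + i) - 1) (by omega)]; simp
    simp only [Int.cast_natCast, Ring.choose_natCast]
    rw [finsum_eq_sum_of_support_subset (s := range (l + 1))]
    swap
    · intro i hi
      rw [Function.mem_support] at hi
      rw [coe_range, Set.mem_Iio]
      by_contra hc
      apply hi
      rw [Nat.choose_eq_zero_of_lt (by omega)]; simp
    simp only [smul_add, Finset.sum_add_distrib]
    rw [← Finset.sum_range_reflect (fun i : ℕ => ((-1 : ℂ) ^ i * (l.choose i : ℂ)) •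
      (-1 : ℂ) ^ ((l : ℤ) + 1) • (divPowZ D (-((l : ℤ) + n - i) - 1) v *
        (divPowZ D (-(m + i) - 1) u * w))), ← Finset.sum_add_distrib]
    refine (Finset.sum_eq_zero fun i hi => ?_).symm
    rw [mem_range] at hi
    rw [show l + 1 - 1 - i = l - i by omega, Nat.choose_symm (by omega),
      show -((l : ℤ) + n - (l - i : ℕ)) - 1 = -(n + i) - 1 by omega,
      show -(m + ((l - i : ℕ) : ℤ)) - 1 = -(l + m - i) - 1 by omega,
      mul_left_comm (divPowZ D (-(n + i) - 1) v), smul_smul, ← add_smul]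
    have : (-1 : ℂ) ^ i * (l.choose i : ℂ) +
        (-1) ^ (l - i) * (l.choose i : ℂ) * (-1) ^ ((l : ℤ) + 1) = 0 := by
      rw [show ((l : ℤ) + 1) = ((l + 1 : ℕ) : ℤ) by push_cast; ring, zpow_natCast]
      obtain ⟨j, rfl⟩ := Nat.exists_eq_add_of_le (show i ≤ l by omega)
      rw [Nat.add_sub_cancel_left]
      have : (-1 : ℂ) ^ j * (-1) ^ j = 1 := by rw [← pow_add, ← two_mul]; simp
      rw [pow_succ, pow_add]
      linear_combination (-(-1 : ℂ) ^ i * ((i + j).choose i : ℂ)) * this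
    rw [this, zero_smul]

/-- The vertex algebra of a commutative algebra `A` with a derivation `D`:
`Y(a, x) b = ∑_{i ≥ 0} (1 / i!) (D ^ i a) b x ^ i`, that is, `a_n b = (1 / i!) (D ^ i a) b` for
`n = -i-1 < 0` and `a_n b = 0` for `n ≥ 0`. -/
noncomputable def VertexAlgebra.ofDerivation {A : Type*} [CommRing A] [Algebra ℂ A]
    (D : Derivation ℂ A A) : VertexAlgebra A where
  vac := 1
  mode n := LinearMap.mul ℂ A ∘ₗ divPowZ D (-n - 1)
  truncation u v := ⟨0, fun n hn => by simp [divPowZ_neg D (show -n - 1 < 0 by omega)]⟩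
  vacuum n v := by
    rw [LinearMap.comp_apply, LinearMap.mul_apply']
    split_ifs with h
    · subst h; simp [divPowZ, divPow]
    · rcases lt_or_ge (-n - 1) 0 with h' | h'
      · rw [divPowZ_neg D h']; simp
      · obtain ⟨k, hk⟩ : ∃ k : ℕ, -n - 1 = (k + 1 : ℕ) := ⟨(-n - 2).toNat, by omega⟩
        rw [hk, divPowZ_natCast]
        simp [divPow, pow_succ]
  creation u := by simp [divPowZ, divPow]
  creation_nonneg n u hn := by simp [divPowZ_neg D (show -n - 1 < 0 by omega)]
  borcherds l m n u v w := by
    simpa only [LinearMap.comp_apply, LinearMap.mul_apply'] using comm_borcherds D l m n u v w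

/-- The module `(M, Y_M)` for the vertex algebra `(A, D)` comes from a module for the associative
algebra `A`: there is an `A`-module structure `ρ` on `M` with
`Y_M(a, x) w = ∑_{i ≥ 0} (1 / i!) ρ(D ^ i a) w x ^ i`. -/
def ComesFromAssociative {A : Type*} [CommRing A] [Algebra ℂ A] {D : Derivation ℂ A A}
    {M : Type*} [AddCommGroup M] [Module ℂ M]
    (Y : UntwistedModule (VertexAlgebra.ofDerivation D) M) : Prop :=
  ∃ ρ : A →ₐ[ℂ] Module.End ℂ M, ∀ (a : A) (w : M),
    (∀ i : ℕ, Y.mode (-(i : ℤ) - 1) a w = ρ (((i.factorial : ℂ)⁻¹) • D^[i] a) w) ∧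
    (∀ k : ℤ, 0 ≤ k → Y.mode k a w = 0)

/-- The restriction of a derivation to a stable subalgebra. -/
def restrictDerivation {A : Type*} [CommRing A] [Algebra ℂ A] (D : Derivation ℂ A A)
    (S : Subalgebra ℂ A) (h : ∀ a ∈ S, D a ∈ S) : Derivation ℂ S S where
  toFun a := ⟨D a, h a a.2⟩
  map_add' a b := by ext; simp
  map_smul' r a := by ext; simp
  map_one_eq_zero' := by ext; simp
  leibniz' a b := by ext; simp

/-- The derivation `f(t) d/dt` of `ℂ[t]`. -/
noncomputable def polyDerivation (f : ℂ[X]) : Derivation ℂ ℂ[X] ℂ[X] :=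
  f • Polynomial.derivative'

end CommutativeAlgebra

/-!
A module for the vertex algebra of a commutative algebra `A` with a derivation `D`, on a
finite-dimensional space `M`, is the same as an algebra homomorphism `a ↦ Y(a, x)` from `A` to the
Laurent series over a commutative algebra `B` of operators on `M` which intertwines `D` with `d/dx`.
One direction is `UntwistedModule.seriesHom`. The other is `TwistedModule.ofLaurent`, for Laurent
series in `y = x ^ (1 / p)`: on the monomials `y ^ a` and `y ^ b` the Borcherds identity reduces to
the Vandermonde identity for the binomial coefficients of `m / p + a / p`. The module comes from an
associative algebra precisely when no `Y(a, x)` has a pole.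

For `A = ℂ[t ^ p]` such a module is one series `f = Y(t ^ p, x)` with `f' = p c₁ f + p c f ^ 2`. If
`M` is indecomposable, Fitting's lemma makes every element of `B` a unit or nilpotent. A nilpotent
`f` has no poles. Otherwise `f` is invertible and `U = f⁻¹` solves the linear equation
`U' = -p c₁ U - p c`, so `U` has no poles; if `U(0)` is a unit, then `f` has no poles either
(`HahnSeries.riccati_dichotomy`). If `U(0)` is nilpotent, then `U` is, up to nilpotents,
`-p c x (1 + ⋯)`, so `f(y ^ p)` has a `p`-th root `T` in `y⁻¹ B((y ^ p))`
(`HahnSeries.exists_root_of_riccati`). Since `T ^ p = f(y ^ p)`, differentiation gives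
`T' = c₁ T + c T ^ (p + 1)`, and `Y(t, x) = T` makes the space `M` itself a twisted module which
restricts to the given one.

If `M` comes from the associative algebra, then `M ≅ ℂ[s] / (s - a) ^ m` with `s = t ^ p`. For
`b ^ p = a`, let `e` be the multiplicity of `b` as a root of `t ^ p - a`. The substitution
`s ↦ t ^ p` embeds `M` into `ℂ[t] / (t - b) ^ (e m)` (`Polynomial.pow_dvd_expand_iff`), which is
indecomposable because it is a local ring.
-/

/-! ### Twisted modules from Laurent series -/

theorem Ring.succ_mul_choose_succ (z : ℂ) (k : ℕ) :
    ((k : ℂ) + 1) * Ring.choose z (k + 1) = Ring.choose z k * (z - k) := by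
  have h := Ring.choose_smul_choose z (Nat.le_succ k)
  simpa [Nat.choose_succ_self_right, Ring.choose_one_right] using h

theorem succ_smul_divPow_succ {A : Type*} [CommRing A] [Algebra ℂ A] (D : Derivation ℂ A A)
    (k : ℕ) (a : A) : ((k : ℂ) + 1) • divPow D (k + 1) a = D (divPow D k a) := by
  have h := divPow_divPow D 1 k a
  rw [add_comm 1 k, Nat.choose_succ_self_right] at h
  rw [← Nat.cast_succ, ← h]
  simp [divPow]

namespace HahnSeries

variable {B : Type*} [CommRing B]

/-- The coefficientwise algebra structure. It is restated because instance search would otherwise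
find the one induced by the `ℂ`-algebra of power series, which is not reducibly equal to it. -/
noncomputable instance complexAlgebra [Algebra ℂ B] : Algebra ℂ (HahnSeries ℤ B) :=
  instAlgebra

theorem exists_coeff_eq_zero_of_lt (f : HahnSeries ℤ B) : ∃ N : ℤ, ∀ n < N, f.coeff n = 0 :=
  ⟨f.order, fun _ hn => coeff_eq_zero_of_lt_order hn⟩

theorem coeff_mul_eq_sum_Icc (f g : HahnSeries ℤ B) (c lo hi : ℤ)
    (hf : ∀ n < lo, f.coeff n = 0) (hg : ∀ n < c - hi, g.coeff n = 0) :
    (f * g).coeff c = ∑ a ∈ Finset.Icc lo hi, f.coeff a * g.coeff (c - a) := by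
  rw [coeff_mul]
  refine Finset.sum_of_injOn Prod.fst ?_ ?_ ?_ ?_
  · rintro ⟨a, b⟩ h ⟨a', b'⟩ h' rfl
    simp only [Finset.mem_coe, Finset.mem_antidiagonal] at h h'
    ext
    · rfl
    · simp only at *; omega
  · rintro ⟨a, b⟩ h
    simp only [Finset.mem_coe, Finset.mem_antidiagonal, mem_support, Finset.mem_Icc] at h ⊢
    obtain ⟨ha, hb, hab⟩ := h
    constructor
    · by_contra hc; exact ha (hf a (by omega))
    · by_contra hc; exact hb (hg b (by omega))
  · intro a _ ha
    by_contra hne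
    apply ha
    refine ⟨(a, c - a), ?_, rfl⟩
    simp only [Finset.mem_coe, Finset.mem_antidiagonal, mem_support]
    exact ⟨left_ne_zero_of_mul hne, right_ne_zero_of_mul hne, by omega⟩
  · rintro ⟨a, b⟩ h
    simp only [Finset.mem_antidiagonal] at h
    rw [show c - a = b by omega]

end HahnSeries

section OfLaurent

open Finset

variable {A : Type*} [CommRing A] [Algebra ℂ A] {D : Derivation ℂ A A}
  {p : ℕ} {B : Type*} [CommRing B] [Algebra ℂ B] {W : Type*} [AddCommGroup W] [Module ℂ W]

/-- Let `x = y ^ p`. The hypothesis `hD` says that `ρ` intertwines `D` with `d/dx`, whose divided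
powers act on `y ^ n` through the binomial coefficients of the exponent `n / p`. -/
theorem coeff_divPow (hp : 0 < p) (ρ : A →ₐ[ℂ] HahnSeries ℤ B)
    (hD : ∀ (a : A) (n : ℤ), (n : ℂ) • (ρ a).coeff n = (p : ℂ) • (ρ (D a)).coeff (n - p))
    (j : ℕ) (a : A) (n : ℤ) :
    (ρ (divPow D j a)).coeff n = Ring.choose ((n : ℂ) / p + j) j • (ρ a).coeff (n + p * j) := by
  have hp' : (p : ℂ) ≠ 0 := by exact_mod_cast hp.ne'
  induction j generalizing n with
  | zero => simp [divPow]
  | succ j ih =>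
    have hj : ((j : ℂ) + 1) ≠ 0 := by exact_mod_cast j.succ_ne_zero
    have h1 : ((j : ℂ) + 1) • (ρ (divPow D (j + 1) a)).coeff n =
        (ρ (D (divPow D j a))).coeff n := by
      rw [← succ_smul_divPow_succ, map_smul, HahnSeries.coeff_smul]
    have h2 := hD (divPow D j a) (n + p)
    rw [add_sub_cancel_right, ih] at h2
    rw [← smul_right_inj hj, h1, ← smul_right_inj hp', ← h2, smul_smul, smul_smul, smul_smul,
      show n + p + (p : ℤ) * j = n + p * ((j + 1 : ℕ) : ℤ) by push_cast; ring]
    congr 1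
    have h3 := Ring.succ_mul_choose_succ ((n : ℂ) / p + (j + 1 : ℕ)) j
    rw [mul_assoc, h3]
    push_cast
    rw [show ((n : ℂ) + p) / p + j = n / p + (j + 1) by field_simp; ring]
    field_simp
    ring

/-- The operators `u_{k / p}`, acting on `W` through `π`, where `ρ u = ∑ u_{k / p} y ^ (-k - p)`. -/
noncomputable def laurentMode (p : ℕ) (ρ : A →ₐ[ℂ] HahnSeries ℤ B) (π : B →ₐ[ℂ] Module.End ℂ W)
    (k : ℤ) : A →ₗ[ℂ] W →ₗ[ℂ] W :=
  π.toLinearMap ∘ₗ HahnSeries.coeff.linearMap (-k - p) ∘ₗ ρ.toLinearMap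

theorem laurentMode_apply (ρ : A →ₐ[ℂ] HahnSeries ℤ B) (π : B →ₐ[ℂ] Module.End ℂ W)
    (k : ℤ) (a : A) (w : W) : laurentMode p ρ π k a w = π ((ρ a).coeff (-k - p)) w := rfl

/-- The operator `(u_j v)_{k / p}` for `j = -q - 1`, as a sum over the exponents `a` of `y` in the
series of `u`. -/
theorem laurentMode_ofDerivation_mode (hp : 0 < p) (ρ : A →ₐ[ℂ] HahnSeries ℤ B)
    (π : B →ₐ[ℂ] Module.End ℂ W)
    (hD : ∀ (a : A) (n : ℤ), (n : ℂ) • (ρ a).coeff n = (p : ℂ) • (ρ (D a)).coeff (n - p))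
    (u v : A) (k j : ℤ) (q : ℕ) (hq : -j - 1 = q) (P lo hi : ℤ) (hP : P = -k - p + p * q)
    (hu : ∀ n < lo, (ρ u).coeff n = 0) (hv : ∀ n < P - hi, (ρ v).coeff n = 0) (w : W) :
    laurentMode p ρ π k ((VertexAlgebra.ofDerivation D).mode j u v) w =
      ∑ a ∈ Icc lo hi, Ring.choose ((a : ℂ) / p) q •
        π ((ρ u).coeff a * (ρ v).coeff (P - a)) w := by
  have hp' : (p : ℂ) ≠ 0 := by exact_mod_cast hp.ne'
  have h1 : (VertexAlgebra.ofDerivation D).mode j u v = divPow D q u * v := by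
    simp only [VertexAlgebra.ofDerivation, LinearMap.comp_apply, LinearMap.mul_apply', hq,
      divPowZ_natCast]
  rw [h1, laurentMode_apply, map_mul,
    HahnSeries.coeff_mul_eq_sum_Icc _ _ _ (lo - p * q) (hi - p * q), map_sum,
    LinearMap.sum_apply]
  · refine Finset.sum_nbij' (fun a => a + p * q) (fun a => a - p * q) ?_ ?_ ?_ ?_ ?_
    · intro a ha; simp only [mem_Icc] at *; omega
    · intro a ha; simp only [mem_Icc] at *; omega
    · intro a _; simp
    · intro a _; simp
    · intro a _
      rw [coeff_divPow hp ρ hD, smul_mul_assoc, map_smul, LinearMap.smul_apply]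
      congr 3
      · push_cast; field_simp
      · congr 2; rw [hP]; ring
  · intro n hn
    rw [coeff_divPow hp ρ hD, hu _ (by omega), smul_zero]
  · intro n hn
    exact hv n (by omega)

theorem laurentMode_borcherds (hp : 0 < p) (ρ : A →ₐ[ℂ] HahnSeries ℤ B)
    (π : B →ₐ[ℂ] Module.End ℂ W)
    (hD : ∀ (a : A) (n : ℤ), (n : ℂ) • (ρ a).coeff n = (p : ℂ) • (ρ (D a)).coeff (n - p))
    (u v : A) (l m n : ℤ) (hu : ∀ k, (ρ u).coeff k ≠ 0 → (p : ℤ) ∣ k + m) (w : W) :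
    ∑ᶠ i : ℕ, Ring.choose ((m : ℂ) / p) i • laurentMode p ρ π (m + n - p * i)
        ((VertexAlgebra.ofDerivation D).mode (l + i) u v) w =
      ∑ᶠ i : ℕ, ((-1 : ℂ) ^ i * Ring.choose (l : ℂ) i) •
        (laurentMode p ρ π (p * l + m - p * i) u (laurentMode p ρ π (n + p * i) v w) +
          (-1 : ℂ) ^ (l + 1) • laurentMode p ρ π (p * l + n - p * i) v
            (laurentMode p ρ π (m + p * i) u w)) := by
  have hp' : (p : ℂ) ≠ 0 := by exact_mod_cast hp.ne'
  have hpz : (0 : ℤ) < p := by exact_mod_cast hp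
  have key : ∀ (k k' : ℤ) (a b : A), laurentMode p ρ π k a (laurentMode p ρ π k' b w) =
      π ((ρ a).coeff (-k - p) * (ρ b).coeff (-k' - p)) w := by
    intro k k' a b; simp [laurentMode_apply]
  have key' : ∀ (k k' : ℤ) (a b : A), laurentMode p ρ π k a (laurentMode p ρ π k' b w) =
      π ((ρ b).coeff (-k' - p) * (ρ a).coeff (-k - p)) w := by
    intro k k' a b; rw [key, mul_comm]
  rcases lt_or_ge l 0 with hl | hl
  · obtain ⟨k, hk⟩ : ∃ k : ℕ, l = -(k + 1 : ℕ) := ⟨l.natAbs - 1, by omega⟩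
    have hsign : (-1 : ℂ) ^ (l + 1) = (-1) ^ k := by
      rw [hk, show (-((k + 1 : ℕ) : ℤ) + 1) = -(k : ℤ) by push_cast; ring, zpow_neg, zpow_natCast,
        ← inv_pow]; norm_num
    simp only [hsign]
    subst hk
    simp only [ring_choose_neg_succ]
    obtain ⟨lo, hlo⟩ := (ρ u).exists_coeff_eq_zero_of_lt
    obtain ⟨lo', hlo'⟩ := (ρ v).exists_coeff_eq_zero_of_lt
    -- `H a` collects the product of the coefficients of `u` at `y ^ a` and of `v` at `y ^ (P - a)`;
    -- the weight `P` is the same in all the terms of both sides.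
    set P : ℤ := p * k - p - m - n with hP
    set hi : ℤ := P - lo' with hhi
    set H : ℤ → W := fun a => π ((ρ u).coeff a * (ρ v).coeff (P - a)) w with hH
    have hHlo : ∀ a, a ∉ Icc lo hi → H a = 0 := by
      intro a ha
      simp only [mem_Icc, not_and_or, not_le] at ha
      rcases ha with ha | ha
      · simp [hH, hlo a ha]
      · simp [hH, hlo' (P - a) (by omega)]
    have hHp : ∀ a, H a ≠ 0 → (p : ℤ) ∣ a + m := by
      intro a ha
      apply hu
      intro h0
      simp [hH, h0] at ha
    have hHval : ∀ a, H a = ∑ b ∈ Icc lo hi, (if b = a then (1 : ℂ) else 0) • H b := by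
      intro a
      by_cases ha : a ∈ Icc lo hi
      · rw [Finset.sum_eq_single a] <;> simp +contextual [ha]
      · rw [hHlo a ha, Finset.sum_eq_zero]
        intro b hb
        rw [if_neg (by rintro rfl; exact ha hb), zero_smul]
    have hL : ∑ᶠ i : ℕ, Ring.choose ((m : ℂ) / p) i • laurentMode p ρ π (m + n - p * i)
        ((VertexAlgebra.ofDerivation D).mode (-((k + 1 : ℕ) : ℤ) + i) u v) w =
        ∑ a ∈ Icc lo hi, Ring.choose ((m : ℂ) / p + a / p) k • H a := by
      rw [finsum_eq_sum_of_support_subset (s := range (k + 1))]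
      swap
      · intro i hi
        rw [Function.mem_support] at hi
        rw [coe_range, Set.mem_Iio]
        by_contra hc
        apply hi
        simp only [VertexAlgebra.ofDerivation, LinearMap.comp_apply]
        rw [divPowZ_neg D (j := -(-((k + 1 : ℕ) : ℤ) + i) - 1) (by push_cast; omega)]
        simp
      rw [Finset.sum_congr rfl fun i hi' => by
        rw [laurentMode_ofDerivation_mode hp ρ π hD u v _ _ (k - i) (by
            rw [mem_range] at hi'; push_cast [show i ≤ k by omega]; ring) P lo hi (by
            rw [mem_range] at hi'; push_cast [show i ≤ k by omega]; rw [hP]; ring)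
            hlo (fun n hn => hlo' n (by omega)), Finset.smul_sum], Finset.sum_comm]
      refine Finset.sum_congr rfl fun a _ => ?_
      simp only [smul_smul]
      rw [← Finset.sum_smul, Ring.add_choose_eq k (Commute.all _ _),
        Nat.sum_antidiagonal_eq_sum_range_succ_mk]
    rw [hL]
    set N : ℕ := k + lo.natAbs + hi.natAbs + m.natAbs + P.natAbs + 1 with hN
    have hR : ∀ i : ℕ, ((k + i).choose k : ℂ) •
        (laurentMode p ρ π (p * -((k + 1 : ℕ) : ℤ) + m - p * i) u
          (laurentMode p ρ π (n + p * i) v w) +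
        (-1 : ℂ) ^ k • laurentMode p ρ π (p * -((k + 1 : ℕ) : ℤ) + n - p * i) v
            (laurentMode p ρ π (m + p * i) u w)) =
        ((k + i).choose k : ℂ) • (H (p * (k + i) - m) + (-1 : ℂ) ^ k • H (p * (-1 - i) - m)) := by
      intro i
      rw [key, key']
      simp only [hH]
      rw [show -(p * -((k + 1 : ℕ) : ℤ) + m - p * i) - p = p * (k + i) - m by push_cast; ring,
        show -(n + p * i) - p = P - (p * (k + i) - m) by rw [hP]; ring,
        show -(m + p * i) - p = p * (-1 - (i : ℤ)) - m by ring,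
        show -(p * -((k + 1 : ℕ) : ℤ) + n - p * i) - p = P - (p * (-1 - i) - m) by
          rw [hP]; push_cast; ring]
    simp only [hR]
    rw [finsum_eq_sum_of_support_subset (s := range N)]
    swap
    · intro i hi'
      rw [Function.mem_support] at hi'
      rw [coe_range, Set.mem_Iio]
      by_contra hc
      apply hi'
      have e1 : (k + i : ℤ) ≤ p * (k + i) := le_mul_of_one_le_left (by omega) (by omega)
      have e2 : (1 + i : ℤ) ≤ p * (1 + i) := le_mul_of_one_le_left (by omega) (by omega)
      rw [hHlo _ (by rw [mem_Icc]; omega), hHlo (p * (-1 - i) - m) (by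
        rw [mem_Icc, show (p : ℤ) * (-1 - i) = -(p * (1 + i)) by ring]; omega)]
      simp
    have hR' : ∀ i ∈ range N, ((k + i).choose k : ℂ) • (H (p * (k + i) - m) +
        (-1 : ℂ) ^ k • H (p * (-1 - i) - m)) = ∑ a ∈ Icc lo hi,
          (((k + i).choose k : ℂ) * (if a = p * (k + i) - m then 1 else 0) +
          (-1 : ℂ) ^ k * ((k + i).choose k : ℂ) * (if a = p * (-1 - i) - m then 1 else 0)) •
            H a := by
      intro i _
      rw [hHval (p * (k + i) - m), hHval (p * (-1 - i) - m), Finset.smul_sum,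
        ← Finset.sum_add_distrib, Finset.smul_sum]
      refine Finset.sum_congr rfl fun a _ => ?_
      rw [smul_smul, ← add_smul, smul_smul]
      congr 1
      ring
    rw [Finset.sum_congr rfl hR', Finset.sum_comm]
    refine Finset.sum_congr rfl fun a ha => ?_
    rw [← Finset.sum_smul]
    by_cases h0 : H a = 0
    · rw [h0, smul_zero, smul_zero]
    obtain ⟨q, hq⟩ := hHp a h0
    rw [mem_Icc] at ha
    have hqN : q.natAbs < N := by
      have : q.natAbs ≤ (p * q : ℤ).natAbs := by
        rw [Int.natAbs_mul, Int.natAbs_natCast]; exact Nat.le_mul_of_pos_left _ hp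
      omega
    have hchoose := ring_choose_int_cases k q N hqN
    have hq' : (m : ℂ) / p + a / p = q := by
      rw [← add_div, div_eq_iff hp', mul_comm (q : ℂ), add_comm]; exact_mod_cast hq
    -- both sides have the coefficient `Ring.choose q k` at `H a`, where `a + m = p q`
    rw [hq', ← hchoose]
    congr 1
    refine Finset.sum_congr rfl fun i _ => ?_
    have e1 : a = p * (k + i) - m ↔ q = k + i := by
      rw [eq_sub_iff_add_eq, hq]; exact mul_right_inj' hpz.ne'
    have e2 : a = p * (-1 - i) - m ↔ q = -1 - i := by
      rw [eq_sub_iff_add_eq, hq]; exact mul_right_inj' hpz.ne'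
    simp only [e1, e2]
  · lift l to ℕ using hl
    rw [finsum_eq_zero_of_forall_eq_zero]
    swap
    · intro i
      simp only [VertexAlgebra.ofDerivation, LinearMap.comp_apply]
      rw [divPowZ_neg D (j := -((l : ℤ) + i) - 1) (by omega)]; simp
    simp only [Int.cast_natCast, Ring.choose_natCast]
    rw [finsum_eq_sum_of_support_subset (s := range (l + 1))]
    swap
    · intro i hi
      rw [Function.mem_support] at hi
      rw [coe_range, Set.mem_Iio]
      by_contra hc
      apply hi
      rw [Nat.choose_eq_zero_of_lt (by omega)]; simp
    simp only [smul_add, Finset.sum_add_distrib]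
    rw [← Finset.sum_range_reflect (fun i : ℕ => ((-1 : ℂ) ^ i * (l.choose i : ℂ)) •
      (-1 : ℂ) ^ ((l : ℤ) + 1) • laurentMode p ρ π (p * l + n - p * i) v
            (laurentMode p ρ π (m + p * i) u w)), ← Finset.sum_add_distrib]
    refine (Finset.sum_eq_zero fun i hi => ?_).symm
    rw [mem_range] at hi
    rw [show l + 1 - 1 - i = l - i by omega, Nat.choose_symm (by omega), key, key']
    push_cast [show i ≤ l by omega]
    rw [show (p : ℤ) * l + n - p * (l - i) = n + p * i by ring,
      show m + (p : ℤ) * (l - i) = p * l + m - p * i by ring, smul_smul, ← add_smul]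
    have : (-1 : ℂ) ^ i * (l.choose i : ℂ) +
        (-1) ^ (l - i) * (l.choose i : ℂ) * (-1) ^ ((l : ℤ) + 1) = 0 := by
      rw [show ((l : ℤ) + 1) = ((l + 1 : ℕ) : ℤ) by push_cast; ring, zpow_natCast]
      obtain ⟨j, rfl⟩ := Nat.exists_eq_add_of_le (show i ≤ l by omega)
      rw [Nat.add_sub_cancel_left]
      have : (-1 : ℂ) ^ j * (-1) ^ j = 1 := by rw [← pow_add, ← two_mul]; simp
      rw [pow_succ, pow_add]
      linear_combination (-(-1 : ℂ) ^ i * ((i + j).choose i : ℂ)) * this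
    rw [this, zero_smul]

/-- An algebra homomorphism `ρ` from `A` to Laurent series in `y = x ^ (1 / p)` which intertwines
`D` with `d/dx` and respects the grading by the eigenspaces of `g` makes every module `W` for the
coefficient ring a `g`-twisted `(A, D)`-module. If `g u = ζ ^ r u`, the exponents of `y` in `ρ u`
have to lie in `-r + p ℤ`. -/
noncomputable def TwistedModule.ofLaurent (hp : 0 < p) (g : A →ₗ[ℂ] A) (ζ : ℂ)
    (ρ : A →ₐ[ℂ] HahnSeries ℤ B) (π : B →ₐ[ℂ] Module.End ℂ W)
    (hD : ∀ (a : A) (n : ℤ), (n : ℂ) • (ρ a).coeff n = (p : ℂ) • (ρ (D a)).coeff (n - p))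
    (hg : ∀ (r : ℕ) (u : A), g u = ζ ^ r • u → ∀ k, (ρ u).coeff k ≠ 0 → (p : ℤ) ∣ k + r) :
    TwistedModule (VertexAlgebra.ofDerivation D) g p ζ W where
  mode := laurentMode p ρ π
  grading r u hu k hk := by
    ext w
    rw [laurentMode_apply]
    by_contra h
    apply hk
    obtain ⟨q, hq⟩ := hg r u hu (-k - p) (fun h0 => h (by simp [h0]))
    refine ((Int.modEq_iff_dvd).2 ⟨q + 1, ?_⟩)
    linear_combination hq
  truncation u w := by
    obtain ⟨N, hN⟩ := (ρ u).exists_coeff_eq_zero_of_lt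
    refine ⟨-N - p + 1, fun k hk => ?_⟩
    rw [laurentMode_apply, hN _ (by omega)]; simp
  vacuum k w := by
    rw [laurentMode_apply]
    change π ((ρ 1).coeff _) w = _
    rw [map_one, HahnSeries.coeff_one]
    by_cases h : k = -p
    · subst h; simp
    · rw [if_neg (by omega), if_neg h]; simp
  borcherds r s u v hu hv l m n hm hn w := by
    refine laurentMode_borcherds hp ρ π hD u v l m n (fun k hk => ?_) w
    obtain ⟨q, hq⟩ := hg r u hu k hk
    obtain ⟨q', hq'⟩ := (Int.modEq_iff_dvd).1 hm
    exact ⟨q - q', by linear_combination hq - hq'⟩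

end OfLaurent

/-! ### The Laurent series of an untwisted module -/

section Untwisted

open Finset
open scoped IsMulCommutative

variable {A : Type*} [CommRing A] [Algebra ℂ A] {D : Derivation ℂ A A}
  {M : Type*} [AddCommGroup M] [Module ℂ M]

namespace UntwistedModule

theorem borcherds_apply (Y : UntwistedModule (VertexAlgebra.ofDerivation D) M) (u v : A)
    (l m n : ℤ) (w : M) :
    ∑ᶠ i : ℕ, Ring.choose (m : ℂ) i •
        Y.mode (m + n - i) (divPowZ D (-(l + i) - 1) u * v) w =
      ∑ᶠ i : ℕ, ((-1 : ℂ) ^ i * Ring.choose (l : ℂ) i) •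
        (Y.mode (l + m - i) u (Y.mode (n + i) v w) +
          (-1 : ℂ) ^ (l + 1) • Y.mode (l + n - i) v (Y.mode (m + i) u w)) := by
  have h := Y.borcherds 0 0 u v (by simp) (by simp) l m n
    (by rw [Nat.cast_one]; exact Int.modEq_one) (by rw [Nat.cast_one]; exact Int.modEq_one) w
  simpa only [Nat.cast_one, div_one, one_mul, VertexAlgebra.ofDerivation, LinearMap.comp_apply,
    LinearMap.mul_apply'] using h

theorem mode_comm (Y : UntwistedModule (VertexAlgebra.ofDerivation D) M) (u v : A)
    (m n : ℤ) (w : M) : Y.mode m u (Y.mode n v w) = Y.mode n v (Y.mode m u w) := by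
  have h := borcherds_apply Y u v 0 m n w
  rw [finsum_eq_zero_of_forall_eq_zero, finsum_eq_single _ 0] at h
  · simp only [Int.cast_zero, Ring.choose_zero_right, zero_add, Nat.cast_zero, sub_zero, add_zero,
      pow_zero, mul_one, one_smul, zpow_one, neg_smul] at h
    exact (sub_eq_zero.1 ((sub_eq_add_neg _ _).trans h.symm))
  · intro i hi
    rw [Int.cast_zero, Ring.choose_zero_pos ℂ (Nat.pos_of_ne_zero hi)]
    simp
  · intro i
    rw [divPowZ_neg D (j := -((0 : ℤ) + i) - 1) (by omega)]; simp

/-- With the commutativity of the modes this says `Y(u v, x) = Y(u, x) Y(v, x)`. -/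
theorem mode_mul (Y : UntwistedModule (VertexAlgebra.ofDerivation D) M) (u v : A)
    (n : ℤ) (w : M) : Y.mode n (u * v) w =
      ∑ᶠ i : ℕ, (Y.mode (-1 - i) u (Y.mode (n + i) v w) +
        Y.mode (-1 + n - i) v (Y.mode i u w)) := by
  have h := borcherds_apply Y u v (-1) 0 n w
  rw [finsum_eq_single _ 0] at h
  · have h' := ring_choose_neg_succ 0
    simp only [zero_add, Nat.choose_zero_right, Nat.cast_one] at h'
    simp only [h'] at h
    simpa [divPowZ, divPow] using h
  · intro i hi
    rw [Int.cast_zero, Ring.choose_zero_pos ℂ (Nat.pos_of_ne_zero hi)]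
    simp

theorem mode_one (Y : UntwistedModule (VertexAlgebra.ofDerivation D) M) (k : ℤ) (w : M) :
    Y.mode k 1 w = if k = -1 then w else 0 := by
  have h := Y.vacuum k w
  rwa [Nat.cast_one] at h

/-- `Y(D u, x) = d/dx Y(u, x)`, by comparing the modes of `u_{-2} 1 = D u`. -/
theorem mode_derivation (Y : UntwistedModule (VertexAlgebra.ofDerivation D) M) (u : A)
    (n : ℤ) (w : M) : Y.mode n (D u) w = -(n : ℂ) • Y.mode (n - 1) u w := by
  have h := borcherds_apply Y u 1 (-2) 0 n w
  rw [finsum_eq_single _ 0] at h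
  · have h' : ∀ i : ℕ, (-1 : ℂ) ^ i * Ring.choose ((-2 : ℤ) : ℂ) i = 1 + i := fun i => by
      rw [show (-2 : ℤ) = -((1 + 1 : ℕ) : ℤ) by norm_num, ring_choose_neg_succ]
      simp
    have hs : (-1 : ℂ) ^ (-2 + 1 : ℤ) = -1 := by norm_num
    have hl : divPowZ D (-(-2 + ((0 : ℕ) : ℤ)) - 1) u * 1 = D u := by simp [divPowZ, divPow]
    simp only [h', mode_one, hs, hl, Int.cast_zero, Ring.choose_zero_right, one_smul] at h
    rw [show (0 : ℤ) + n - (0 : ℕ) = n by simp] at h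
    rw [h]
    rcases lt_trichotomy n 0 with hn | hn | hn
    · obtain ⟨k, hk⟩ : ∃ k : ℕ, n = -(k + 1 : ℕ) := ⟨n.natAbs - 1, by omega⟩
      rw [finsum_eq_single _ k]
      · rw [if_pos (by omega), if_neg (by omega), hk]
        push_cast
        simp only [smul_zero, add_zero]
        congr 1
        · ring
        · congr 2; ring_nf
      · intro i hi
        rw [if_neg (by omega), if_neg (by omega)]; simp
    · rw [finsum_eq_zero_of_forall_eq_zero]
      · simp [hn]
      · intro i
        rw [if_neg (by omega), if_neg (by omega)]; simp
    · obtain ⟨k, hk⟩ : ∃ k : ℕ, n = (k + 1 : ℕ) := ⟨n.natAbs - 1, by omega⟩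
      rw [finsum_eq_single _ k]
      · rw [if_neg (by omega), if_pos (by omega), hk]
        push_cast
        simp only [map_zero, zero_add, smul_smul]
        congr 1
        · ring
        · congr 2; ring_nf
      · intro i hi
        rw [if_neg (by omega), if_neg (by omega)]; simp
  · intro i hi
    rw [Int.cast_zero, Ring.choose_zero_pos ℂ (Nat.pos_of_ne_zero hi)]
    simp

theorem exists_uniform_truncation [FiniteDimensional ℂ M]
    (Y : UntwistedModule (VertexAlgebra.ofDerivation D) M) (u : A) :
    ∃ N : ℤ, ∀ k : ℤ, N ≤ k → Y.mode k u = 0 := by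
  choose N hN using Y.truncation u
  let b := Module.finBasis ℂ M
  obtain ⟨K, hK⟩ := (Set.finite_range fun i => N (b i)).bddAbove
  exact ⟨K, fun k hk => b.ext fun i => hN _ k ((hK ⟨i, rfl⟩).trans hk)⟩

/-- The algebra of operators generated by all the modes. -/
noncomputable abbrev modeAlgebra (Y : UntwistedModule (VertexAlgebra.ofDerivation D) M) :
    Subalgebra ℂ (Module.End ℂ M) :=
  Algebra.adjoin ℂ (Set.range fun x : ℤ × A => Y.mode x.1 x.2)

instance isMulCommutative_modeAlgebra
    (Y : UntwistedModule (VertexAlgebra.ofDerivation D) M) : IsMulCommutative (modeAlgebra Y) :=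
  Algebra.isMulCommutative_adjoin ℂ (by
    rintro _ ⟨x, rfl⟩ _ ⟨y, rfl⟩
    ext w
    exact mode_comm Y x.2 y.2 x.1 y.1 w)

theorem mode_mem_modeAlgebra (Y : UntwistedModule (VertexAlgebra.ofDerivation D) M) (k : ℤ)
    (a : A) : Y.mode k a ∈ modeAlgebra Y := Algebra.subset_adjoin ⟨(k, a), rfl⟩

/-- The series `Y(a, x) = ∑ a_{-n-1} x ^ n`. -/
noncomputable def series [FiniteDimensional ℂ M]
    (Y : UntwistedModule (VertexAlgebra.ofDerivation D) M) (a : A) :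
    HahnSeries ℤ (modeAlgebra Y) :=
  HahnSeries.ofSuppBddBelow (fun n => ⟨Y.mode (-n - 1) a, mode_mem_modeAlgebra Y _ a⟩) (by
    obtain ⟨N, hN⟩ := exists_uniform_truncation Y a
    refine ⟨-N, fun n hn => ?_⟩
    by_contra hc
    exact hn (Subtype.ext (hN _ (by omega))))

theorem coe_coeff_series [FiniteDimensional ℂ M]
    (Y : UntwistedModule (VertexAlgebra.ofDerivation D) M) (a : A) (n : ℤ) :
    ((series Y a).coeff n : Module.End ℂ M) = Y.mode (-n - 1) a := rfl

theorem _root_.sum_range_add_neg {M : Type*} [AddCommGroup M] {H : ℤ → M} (N : ℕ) :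
    ∑ i ∈ range N, (H i + H (-1 - i)) = ∑ a ∈ Icc (-N : ℤ) (N - 1), H a := by
  induction N with
  | zero => simp
  | succ N ih =>
    rw [Finset.sum_range_succ, ih]
    have : Icc (-((N + 1 : ℕ) : ℤ)) ((N + 1 : ℕ) - 1) =
        insert (N : ℤ) (insert (-1 - N : ℤ) (Icc (-N : ℤ) (N - 1))) := by
      ext a; simp only [mem_Icc, mem_insert]; push_cast; omega
    rw [this, Finset.sum_insert, Finset.sum_insert]
    · abel
    · simp
    · simp only [mem_insert, mem_Icc]; omega

theorem series_mul [FiniteDimensional ℂ M]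
    (Y : UntwistedModule (VertexAlgebra.ofDerivation D) M) (a b : A) :
    series Y (a * b) = series Y a * series Y b := by
  ext n : 2
  obtain ⟨K, hK⟩ := (series Y a).exists_coeff_eq_zero_of_lt
  obtain ⟨L, hL⟩ := (series Y b).exists_coeff_eq_zero_of_lt
  set N : ℕ := K.natAbs + L.natAbs + n.natAbs + 1 with hN
  rw [HahnSeries.coeff_mul_eq_sum_Icc _ _ n (-N) (N - 1) (fun k hk => hK k (by omega))
    (fun k hk => hL k (by omega))]
  apply Subtype.ext
  ext w
  rw [coe_coeff_series, mode_mul]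
  simp only [AddSubmonoidClass.coe_finsetSum, MulMemClass.coe_mul, LinearMap.sum_apply,
    Module.End.mul_apply, coe_coeff_series]
  rw [← sum_range_add_neg, finsum_eq_sum_of_support_subset (s := range N)]
  · refine Finset.sum_congr rfl fun i _ => ?_
    rw [mode_comm Y b a]
    ring_nf
  · intro i hi
    rw [Function.mem_support] at hi
    rw [coe_range, Set.mem_Iio]
    by_contra hc
    apply hi
    have e1 : Y.mode (-n - 1 + i) b = 0 := by
      have h := congrArg Subtype.val (hL (n - i) (by omega))
      rw [coe_coeff_series] at h
      rw [show -n - 1 + (i : ℤ) = -(n - i) - 1 by ring]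
      exact h
    have e2 : Y.mode i a = 0 := by
      have h := congrArg Subtype.val (hK (-i - 1) (by omega))
      rw [coe_coeff_series] at h
      rw [show (i : ℤ) = -(-i - 1) - 1 by ring]
      exact h
    rw [e1, e2]; simp

/-- For a finite-dimensional module, `a ↦ Y(a, x)` is a homomorphism of algebras. -/
noncomputable def seriesHom [FiniteDimensional ℂ M]
    (Y : UntwistedModule (VertexAlgebra.ofDerivation D) M) :
    A →ₐ[ℂ] HahnSeries ℤ (modeAlgebra Y) :=
  AlgHom.ofLinearMap
    { toFun := series Y
      map_add' := fun a b => by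
        ext n : 2
        exact Subtype.ext (map_add (Y.mode (-n - 1)) a b)
      map_smul' := fun c a => by
        ext n : 2
        exact Subtype.ext (map_smul (Y.mode (-n - 1)) c a) }
    (by
      ext n : 2
      apply Subtype.ext
      ext w
      change Y.mode (-n - 1) 1 w = _
      rw [mode_one, HahnSeries.coeff_one]
      by_cases h : n = 0
      · simp [h]
      · rw [if_neg (by omega), if_neg h]; rfl)
    (series_mul Y)

theorem coe_coeff_seriesHom [FiniteDimensional ℂ M]
    (Y : UntwistedModule (VertexAlgebra.ofDerivation D) M) (a : A) (n : ℤ) :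
    ((seriesHom Y a).coeff n : Module.End ℂ M) = Y.mode (-n - 1) a := rfl

theorem coeff_seriesHom_derivation [FiniteDimensional ℂ M]
    (Y : UntwistedModule (VertexAlgebra.ofDerivation D) M) (a : A) (n : ℤ) :
    (n : ℂ) • (seriesHom Y a).coeff n = (seriesHom Y (D a)).coeff (n - 1) := by
  apply Subtype.ext
  ext w
  change (n : ℂ) • Y.mode (-n - 1) a w = Y.mode (-(n - 1) - 1) (D a) w
  rw [mode_derivation]
  push_cast
  congr 1
  · ring
  · congr 2; ring_nf

/-- Fitting's lemma: the kernel and the range of a high power of an operator are complementary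
submodules, so one of them is zero if the module is indecomposable. -/
theorem isUnit_or_isNilpotent [FiniteDimensional ℂ M]
    (Y : UntwistedModule (VertexAlgebra.ofDerivation D) M) (hY : Y.IsIndecomposable)
    (b : modeAlgebra Y) : IsUnit b ∨ IsNilpotent b := by
  obtain ⟨n, hn, hn0⟩ := ((LinearMap.eventually_isCompl_ker_pow_range_pow
    (b : Module.End ℂ M)).and (Filter.eventually_ge_atTop 1)).exists
  have hcomm : ∀ k a w, ((b : Module.End ℂ M) ^ n) (Y.mode k a w) =
      Y.mode k a (((b : Module.End ℂ M) ^ n) w) := fun k a w => by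
    have h := mul_comm (b ^ n) ⟨Y.mode k a, mode_mem_modeAlgebra Y k a⟩
    simpa using LinearMap.congr_fun (congrArg Subtype.val h) w
  have hker : Y.IsSubmodule (LinearMap.ker ((b : Module.End ℂ M) ^ n)) := fun k a w hw => by
    rw [LinearMap.mem_ker] at hw ⊢
    rw [hcomm, hw, map_zero]
  have hrange : Y.IsSubmodule (LinearMap.range ((b : Module.End ℂ M) ^ n)) := by
    rintro k a _ ⟨v, rfl⟩
    exact ⟨Y.mode k a v, hcomm k a v⟩
  rcases hY.2 _ _ hker hrange hn with h | h
  · left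
    have : IsArtinianRing (modeAlgebra Y) := IsArtinianRing.of_finite ℂ _
    apply IsArtinianRing.isUnit_of_mem_nonZeroDivisors
    rw [mem_nonZeroDivisors_iff_right]
    intro x hx
    have hb : Function.Injective ((b : Module.End ℂ M) ^ n) := LinearMap.ker_eq_bot.1 h
    apply Subtype.ext
    ext w
    apply hb
    have : b ^ n * x = 0 := by
      obtain ⟨m, rfl⟩ := Nat.exists_eq_add_of_le' hn0
      rw [pow_succ, mul_assoc, mul_comm b x, hx, mul_zero]
    have := LinearMap.congr_fun (congrArg Subtype.val this) w
    simpa using this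
  · right
    exact ⟨n, Subtype.ext (LinearMap.range_eq_bot.1 h)⟩

end UntwistedModule
end Untwisted

/-! ### A Riccati equation for Laurent series -/

namespace HahnSeries

variable {B : Type*} [CommRing B]

theorem coeff_single_one_mul (f : HahnSeries ℤ B) (d n : ℤ) :
    (single d (1 : B) * f).coeff n = f.coeff (n - d) := by
  rw [coeff_single_mul, one_mul]

/-- Over a Noetherian ring the nilradical is nilpotent, so a series with nilpotent coefficients is
nilpotent. -/
theorem isNilpotent_of_coeff [IsNoetherianRing B] (f : HahnSeries ℤ B)
    (hf : ∀ n, IsNilpotent (f.coeff n)) : IsNilpotent f := by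
  obtain ⟨k, hk⟩ := IsNoetherianRing.isNilpotent_nilradical B
  have h : ∀ j n, (f ^ j).coeff n ∈ nilradical B ^ j := by
    intro j
    induction j with
    | zero => simp
    | succ j ih =>
      intro n
      rw [pow_succ f, coeff_mul, pow_succ (nilradical B)]
      exact Ideal.sum_mem _ fun ij _ => Ideal.mul_mem_mul (ih _) (hf _)
  refine ⟨k, ?_⟩
  ext n
  have := h k n
  rw [hk] at this
  simpa using this

/-- A Laurent series over a local Artinian ring which is not nilpotent is invertible: up to
nilpotents it starts with a unit. -/
theorem isUnit_of_coeff [IsNoetherianRing B] [Nontrivial B]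
    (hB : ∀ b : B, IsUnit b ∨ IsNilpotent b) (f : HahnSeries ℤ B)
    (hf : ∃ n, ¬ IsNilpotent (f.coeff n)) : IsUnit f := by
  obtain ⟨L, hL⟩ := f.exists_coeff_eq_zero_of_lt
  obtain ⟨d, hd, hmin⟩ := Int.exists_least_of_bdd (P := fun n => ¬ IsNilpotent (f.coeff n))
    ⟨L, fun n hn => by
      by_contra hc
      exact hn (by rw [hL n (by omega)]; exact IsNilpotent.zero)⟩ hf
  let g : PowerSeries B := PowerSeries.mk fun n => f.coeff (n + d)
  have hg : IsUnit g := by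
    rw [PowerSeries.isUnit_iff_constantCoeff]
    simpa [g] using (hB _).resolve_right hd
  have hnil : IsNilpotent (single (-d) (1 : B) * f - ofPowerSeries ℤ B g) := by
    refine isNilpotent_of_coeff _ fun n => ?_
    rw [coeff_sub, coeff_single_one_mul, PowerSeries.coeff_coe]
    split_ifs with h
    · by_contra hc
      rw [sub_zero] at hc
      have := hmin _ hc
      omega
    · rw [PowerSeries.coeff_mk, show ((n.natAbs : ℤ) + d) = n - -d by omega, sub_self]
      exact IsNilpotent.zero
  have h := hnil.isUnit_add_left_of_commute (hg.map (ofPowerSeries ℤ B)) (Commute.all _ _)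
  rw [add_sub_cancel] at h
  exact isUnit_of_mul_isUnit_right h

variable [Algebra ℂ B]

/-- The derivation `x d/dx` of the Laurent series. -/
noncomputable def eulerDerivation (B : Type*) [CommRing B] [Algebra ℂ B] :
    Derivation ℂ (HahnSeries ℤ B) (HahnSeries ℤ B) where
  toFun f := ⟨fun n => (n : ℂ) • f.coeff n,
    f.isPWO_support.mono fun n hn h => hn (by simp only [h, smul_zero])⟩
  map_add' f g := by ext n; simp
  map_smul' c f := by ext n; simp [smul_comm c]
  map_one_eq_zero' := by
    ext n
    by_cases h : n = 0 <;> simp [coeff_one, h]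
  leibniz' f g := by
    ext n
    obtain ⟨K, hK⟩ := f.exists_coeff_eq_zero_of_lt
    obtain ⟨L, hL⟩ := g.exists_coeff_eq_zero_of_lt
    simp only [LinearMap.coe_mk, AddHom.coe_mk, smul_eq_mul, coeff_add]
    rw [mul_comm g,
      coeff_mul_eq_sum_Icc f g n K (n - L) hK (fun k hk => hL k (by omega)),
      coeff_mul_eq_sum_Icc f _ n K (n - L) hK (fun k hk => by simp [hL k (by omega)]),
      coeff_mul_eq_sum_Icc _ g n K (n - L) (fun k hk => by simp [hK k hk])
        (fun k hk => hL k (by omega)), Finset.smul_sum, ← Finset.sum_add_distrib]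
    refine Finset.sum_congr rfl fun a _ => ?_
    simp only [mul_smul_comm, smul_mul_assoc, ← add_smul]
    congr 1
    push_cast
    ring

@[simp]
theorem coeff_eulerDerivation (f : HahnSeries ℤ B) (n : ℤ) :
    (eulerDerivation B f).coeff n = (n : ℂ) • f.coeff n := rfl

/-- A solution of the linear equation `f' = a f + r` has no poles if `r` has none. -/
theorem coeff_eq_zero_of_linear (f r : HahnSeries ℤ B) (a : ℂ)
    (hf : eulerDerivation B f = single 1 1 * (a • f + r)) (hr : ∀ n < 0, r.coeff n = 0) :
    ∀ n < 0, f.coeff n = 0 := by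
  obtain ⟨L, hL⟩ := f.exists_coeff_eq_zero_of_lt
  have h : ∀ k : ℕ, L + k ≤ 0 → ∀ n < L + k, f.coeff n = 0 := by
    intro k
    induction k with
    | zero => intro _ n hn; exact hL n (by simpa using hn)
    | succ k ih =>
      intro hk n hn
      push_cast at hk hn
      have h1 := congrArg (fun f => f.coeff n) hf
      simp only [coeff_eulerDerivation, coeff_single_one_mul, coeff_add, coeff_smul] at h1
      rw [hr (n - 1) (by omega), ih (by omega) (n - 1) (by omega), smul_zero, add_zero] at h1
      exact (smul_eq_zero.1 h1).resolve_left (by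
        have : n ≠ 0 := by omega
        exact_mod_cast this)
  intro n hn
  by_cases hLn : n < L
  · exact hL n hLn
  · exact h (n + 1 - L).toNat (by omega) n (by omega)

/-- A nilpotent solution of the Riccati equation `f' = a f + b f ^ 2` has no poles: the powers of
`f` satisfy `(f ^ j)' = j a f ^ j + j b f ^ (j + 1)`, which is linear in `f ^ j` once
`f ^ (j + 1)` is known to have no poles. -/
theorem coeff_eq_zero_of_riccati_of_isNilpotent (f : HahnSeries ℤ B) (a b : ℂ)
    (hf : eulerDerivation B f = single 1 1 * (a • f + b • f ^ 2)) (hnil : IsNilpotent f) :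
    ∀ n < 0, f.coeff n = 0 := by
  obtain ⟨N, hN⟩ := hnil
  have h : ∀ k j : ℕ, N ≤ j + 1 + k → ∀ n < 0, (f ^ (j + 1)).coeff n = 0 := by
    intro k
    induction k with
    | zero =>
      intro j hj n _
      rw [pow_eq_zero_of_le (by omega) hN, coeff_zero]
    | succ k ih =>
      intro j hj
      refine coeff_eq_zero_of_linear _ (((j + 1 : ℕ) * b : ℂ) • f ^ (j + 1 + 1))
        ((j + 1 : ℕ) * a : ℂ) ?_ (fun n hn => ?_)
      · rw [Derivation.leibniz_pow, hf]
        simp only [← Nat.cast_smul_eq_nsmul ℂ, smul_eq_mul, Algebra.smul_def, map_mul,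
          Nat.add_sub_cancel]
        ring
      · rw [coeff_smul, ih (j + 1) (by omega) n hn, smul_zero]
  have := h N 0 (by omega)
  simpa using this

/-- The reciprocal of a solution of a Riccati equation solves a linear equation. -/
theorem eulerDerivation_inv_of_riccati (f U : HahnSeries ℤ B) (a b : ℂ)
    (hf : eulerDerivation B f = single 1 1 * (a • f + b • f ^ 2)) (hU : f * U = 1) :
    eulerDerivation B U = single 1 1 * ((-a) • U + (-b) • 1) := by
  have h := congrArg (eulerDerivation B) hU
  rw [Derivation.leibniz, Derivation.map_one_eq_zero, hf, smul_eq_mul, smul_eq_mul] at h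
  simp only [Algebra.smul_def, map_neg] at h ⊢
  linear_combination U * h - (eulerDerivation B U + single 1 1 * algebraMap ℂ _ a * U
    + single 1 1 * algebraMap ℂ _ b * (f * U + 1)) * hU

/-- A solution of the Riccati equation over a local Artinian ring either has no poles or is the
reciprocal of a solution of the linear equation with nilpotent initial value. -/
theorem riccati_dichotomy [IsNoetherianRing B] [Nontrivial B]
    (hB : ∀ b : B, IsUnit b ∨ IsNilpotent b) (f : HahnSeries ℤ B) (a b : ℂ)
    (hf : eulerDerivation B f = single 1 1 * (a • f + b • f ^ 2)) :
    (∀ n < 0, f.coeff n = 0) ∨ ∃ U : HahnSeries ℤ B, f * U = 1 ∧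
      eulerDerivation B U = single 1 1 * ((-a) • U + (-b) • 1) ∧ (∀ n < 0, U.coeff n = 0) ∧
      IsNilpotent (U.coeff 0) := by
  by_cases h : ∀ n, IsNilpotent (f.coeff n)
  · exact Or.inl (coeff_eq_zero_of_riccati_of_isNilpotent f a b hf (isNilpotent_of_coeff f h))
  push Not at h
  obtain ⟨U, hU⟩ := (isUnit_of_coeff hB f h).exists_right_inv
  have hU' := eulerDerivation_inv_of_riccati f U a b hf hU
  have hreg := coeff_eq_zero_of_linear U _ _ hU' (fun n hn => by
    rw [coeff_smul, coeff_one, if_neg hn.ne, smul_zero])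
  rcases hB (U.coeff 0) with h0 | h0
  · left
    let V : PowerSeries B := PowerSeries.mk fun n => U.coeff n
    have hV : ofPowerSeries ℤ B V = U := by
      ext n
      rw [PowerSeries.coeff_coe]
      split_ifs with hn
      · exact (hreg n hn).symm
      · rw [PowerSeries.coeff_mk, show (n.natAbs : ℤ) = n by omega]
    have hVu : IsUnit V := by
      rw [PowerSeries.isUnit_iff_constantCoeff]
      simpa [V] using h0
    obtain ⟨V', hV'⟩ := hVu.exists_right_inv
    have : f = ofPowerSeries ℤ B V' := by
      have h1 := congrArg (ofPowerSeries ℤ B) hV'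
      rw [map_mul, hV, map_one] at h1
      linear_combination ofPowerSeries ℤ B V' * hU - f * h1
    intro n hn
    rw [this, PowerSeries.coeff_coe, if_pos hn]
  · exact Or.inr ⟨U, hU, hU', hreg, h0⟩

end HahnSeries

/-! ### Roots of Laurent series -/

/-- The root is the binomial series `(1 + (f - 1)) ^ (1 / p)`. -/
theorem PowerSeries.exists_pow_eq {B : Type*} [CommRing B] [Algebra ℂ B] {p : ℕ} (hp : 0 < p)
    (f : PowerSeries B) (hf : PowerSeries.constantCoeff f = 1) :
    ∃ r : PowerSeries B, r ^ p = f := by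
  have hp' : (p : ℂ) ≠ 0 := by exact_mod_cast hp.ne'
  have hsub : PowerSeries.HasSubst (f - 1) :=
    PowerSeries.HasSubst.of_constantCoeff_zero' (by simp [hf])
  have hpow : ∀ n : ℕ, PowerSeries.binomialSeries B (n * (p : ℂ)⁻¹) =
      PowerSeries.binomialSeries B (p : ℂ)⁻¹ ^ n := by
    intro n
    induction n with
    | zero => simp
    | succ n ih =>
      rw [Nat.cast_succ, add_mul, one_mul, PowerSeries.binomialSeries_add, ih, pow_succ]
  have h1 := hpow p
  rw [mul_inv_cancel₀ hp', ← Nat.cast_one, PowerSeries.binomialSeries_nat, pow_one] at h1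
  refine ⟨PowerSeries.substAlgHom (R := B) hsub (PowerSeries.binomialSeries B (p : ℂ)⁻¹), ?_⟩
  rw [← map_pow, ← h1, map_add, map_one, PowerSeries.substAlgHom_X]
  ring

namespace HahnSeries

variable {B : Type*} [CommRing B] [Algebra ℂ B]

/-- The substitution `x ↦ x ^ p` in Laurent series. -/
noncomputable def expand (B : Type*) [CommRing B] [Algebra ℂ B] {p : ℕ} (hp : 0 < p) :
    HahnSeries ℤ B →ₐ[ℂ] HahnSeries ℤ B :=
  embDomainAlgHom (AddMonoidHom.mulLeft (p : ℤ))
    (fun a b h => mul_left_cancel₀ (by exact_mod_cast hp.ne') h)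
    (fun a b => mul_le_mul_iff_right₀ (by exact_mod_cast hp))

theorem coeff_expand_mul {p : ℕ} (hp : 0 < p) (f : HahnSeries ℤ B) (n : ℤ) :
    (expand B hp f).coeff (p * n) = f.coeff n :=
  embDomain_coeff (f := ⟨⟨AddMonoidHom.mulLeft (p : ℤ),
    fun a b h => mul_left_cancel₀ (by exact_mod_cast hp.ne') h⟩,
    mul_le_mul_iff_right₀ (by exact_mod_cast hp)⟩)

theorem coeff_expand_of_not_dvd {p : ℕ} (hp : 0 < p) (f : HahnSeries ℤ B) {n : ℤ}
    (hn : ¬ (p : ℤ) ∣ n) : (expand B hp f).coeff n = 0 :=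
  embDomain_of_notMem_range (f := ⟨⟨AddMonoidHom.mulLeft (p : ℤ),
    fun a b h => mul_left_cancel₀ (by exact_mod_cast hp.ne') h⟩,
    mul_le_mul_iff_right₀ (by exact_mod_cast hp)⟩) (by
      rintro ⟨q, hq⟩
      exact hn ⟨q, hq.symm⟩)

theorem expand_single {p : ℕ} (hp : 0 < p) (n : ℤ) (b : B) :
    expand B hp (single n b) = single (p * n) b :=
  embDomain_single

theorem eulerDerivation_expand {p : ℕ} (hp : 0 < p) (f : HahnSeries ℤ B) :
    eulerDerivation B (expand B hp f) = (p : ℂ) • expand B hp (eulerDerivation B f) := by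
  ext n
  rw [coeff_eulerDerivation, coeff_smul]
  by_cases h : (p : ℤ) ∣ n
  · obtain ⟨n, rfl⟩ := h
    rw [coeff_expand_mul, coeff_expand_mul, coeff_eulerDerivation, smul_smul]
    push_cast
    rfl
  · rw [coeff_expand_of_not_dvd hp _ h, coeff_expand_of_not_dvd hp _ h, smul_zero, smul_zero]

/-- If `U' = -a U - b`, with `U` invertible and without poles and `U(0)` nilpotent, then
`U = -b x (1 + ⋯)` up to nilpotents. So `b ≠ 0` and `U / (-b x)` has a `p`-th root: up to nilpotents
it is a power series with constant coefficient `1`, which has a binomial series as its root, and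
Newton's method corrects the root by a nilpotent. -/
theorem exists_pow_eq_of_linear [IsNoetherianRing B] [Nontrivial B] {p : ℕ} (hp : 0 < p)
    (U : HahnSeries ℤ B) (a b : ℂ) (hUu : IsUnit U)
    (hU : eulerDerivation B U = single 1 1 * ((-a) • U + (-b) • 1))
    (hreg : ∀ n < 0, U.coeff n = 0) (h0 : IsNilpotent (U.coeff 0)) :
    b ≠ 0 ∧ ∃ q : HahnSeries ℤ B, IsUnit q ∧ U = single 1 1 * (-b) • q ^ p := by
  have hrec : ∀ n : ℤ, (n : ℂ) • U.coeff n =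
      (-a) • U.coeff (n - 1) + (-b) • (if n - 1 = 0 then 1 else 0) := fun n => by
    have h := congrArg (fun f => f.coeff n) hU
    simp only [coeff_eulerDerivation, coeff_single_one_mul, coeff_add, coeff_smul, coeff_one] at h
    convert h
  have hb : b ≠ 0 := by
    rintro rfl
    refine hUu.not_isNilpotent (isNilpotent_of_coeff U fun n => ?_)
    rcases lt_or_ge n 0 with hn | hn
    · rw [hreg n hn]; exact IsNilpotent.zero
    · lift n to ℕ using hn
      induction n with
      | zero => exact h0
      | succ n ih =>
        have h := hrec (n + 1 : ℕ)
        rw [neg_zero, zero_smul, add_zero, show ((n + 1 : ℕ) : ℤ) - 1 = n by push_cast; ring] at h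
        have hn' : (((n + 1 : ℕ) : ℤ) : ℂ) ≠ 0 := by exact_mod_cast n.succ_ne_zero
        rw [← inv_smul_smul₀ hn' (U.coeff _), h, smul_smul]
        exact ih.smul _
  refine ⟨hb, ?_⟩
  set W : HahnSeries ℤ B := single (-1) 1 * (-b)⁻¹ • U with hW
  have hb' : -b ≠ 0 := neg_ne_zero.2 hb
  have hWU : single 1 1 * (-b) • W = U := by
    rw [hW, ← mul_smul_comm, smul_smul, mul_inv_cancel₀ hb', one_smul, ← mul_assoc,
      single_mul_single]
    simp
  have hWcoeff : ∀ n, W.coeff n = (-b)⁻¹ • U.coeff (n + 1) := fun n => by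
    rw [hW, coeff_single_one_mul, coeff_smul, sub_neg_eq_add]
  have hWu : IsUnit W := by
    rw [← hWU] at hUu
    have := isUnit_of_mul_isUnit_right hUu
    rw [Algebra.smul_def] at this
    exact isUnit_of_mul_isUnit_right this
  have hW0 : IsNilpotent (W.coeff 0 - 1) := by
    have h := hrec 1
    simp only [Int.cast_one, one_smul, sub_self, if_true] at h
    rw [hWcoeff, zero_add, h, smul_add, smul_smul, smul_smul, inv_mul_cancel₀ hb', one_smul,
      add_sub_cancel_right]
    exact h0.smul _
  let G : PowerSeries B := PowerSeries.mk fun n => if n = 0 then 1 else W.coeff n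
  have hG : PowerSeries.constantCoeff G = 1 := by simp [G]
  have hGW : IsNilpotent (ofPowerSeries ℤ B G - W) := by
    refine isNilpotent_of_coeff _ fun n => ?_
    rw [coeff_sub, PowerSeries.coeff_coe]
    rcases lt_trichotomy n 0 with hn | rfl | hn
    · rw [if_pos hn, zero_sub, isNilpotent_neg_iff, hWcoeff]
      rcases eq_or_ne n (-1) with rfl | hn'
      · exact h0.smul _
      · rw [hreg _ (by omega), smul_zero]; exact IsNilpotent.zero
    · simpa [G] using hW0.neg
    · rw [if_neg (by omega), PowerSeries.coeff_mk, if_neg (by omega),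
        show (n.natAbs : ℤ) = n by omega, sub_self]
      exact IsNilpotent.zero
  obtain ⟨r, hr⟩ := PowerSeries.exists_pow_eq hp G hG
  have hru : IsUnit r := by
    rw [← isUnit_pow_iff hp.ne', hr, PowerSeries.isUnit_iff_constantCoeff, hG]
    exact isUnit_one
  obtain ⟨q, ⟨_, hq⟩, _⟩ := Polynomial.existsUnique_nilpotent_sub_and_aeval_eq_zero
    (P := (Polynomial.X ^ p - Polynomial.C W : (HahnSeries ℤ B)[X])) (x := ofPowerSeries ℤ B r)
    (by simpa [← map_pow, hr] using hGW)
    (by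
      have hpu : IsUnit ((p : ℕ) : HahnSeries ℤ B) := by
        rw [← map_natCast (algebraMap ℂ (HahnSeries ℤ B))]
        exact (IsUnit.mk0 (p : ℂ) (by exact_mod_cast hp.ne')).map _
      simpa [Polynomial.derivative_X_pow] using hpu.mul ((hru.map (ofPowerSeries ℤ B)).pow _))
  have hqW : q ^ p = W := by simpa [sub_eq_zero] using hq
  refine ⟨q, ?_, by rw [hqW, hWU]⟩
  rw [← isUnit_pow_iff hp.ne', hqW]
  exact hWu

/-- The solution `f = U⁻¹` of the Riccati equation has, in `y` with `x = y ^ p`, a `p`-th root of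
the form `y⁻¹ s(y ^ p)`. -/
theorem exists_root_of_riccati [IsNoetherianRing B] [Nontrivial B] {p : ℕ} (hp : 0 < p)
    (f U : HahnSeries ℤ B) (a b : ℂ) (hfU : f * U = 1)
    (hU : eulerDerivation B U = single 1 1 * ((-a) • U + (-b) • 1))
    (hreg : ∀ n < 0, U.coeff n = 0) (h0 : IsNilpotent (U.coeff 0)) :
    ∃ s : HahnSeries ℤ B, (single (-1) 1 * expand B hp s) ^ p = expand B hp f := by
  obtain ⟨hb, q, hq, hUq⟩ := exists_pow_eq_of_linear hp U a b
    (IsUnit.of_mul_eq_one f (by rw [mul_comm, hfU])) hU hreg h0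
  obtain ⟨q', hq'⟩ := hq.exists_right_inv
  obtain ⟨γ, hγ⟩ := IsAlgClosed.exists_pow_nat_eq (-b)⁻¹ hp
  refine ⟨γ • q', ?_⟩
  have h1 : (single (-1) 1 * expand B hp (γ • q')) ^ p * expand B hp U = 1 := by
    have hs : (single (-1 : ℤ) (1 : B)) ^ p * single (p : ℤ) 1 = 1 := by
      rw [single_pow, single_mul_single]; simp
    have hq'' : expand B hp q' ^ p * expand B hp q ^ p = 1 := by
      rw [← mul_pow, ← map_mul, mul_comm q', hq', map_one, one_pow]
    have hγb : algebraMap ℂ (HahnSeries ℤ B) γ ^ p * algebraMap ℂ _ (-b) = 1 := by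
      rw [← map_pow, hγ, ← map_mul, inv_mul_cancel₀ (neg_ne_zero.2 hb), map_one]
    rw [hUq, map_mul, expand_single, map_smul, map_smul, map_pow, mul_one, Algebra.smul_def,
      Algebra.smul_def, mul_pow, mul_pow]
    calc _ = (single (-1 : ℤ) (1 : B) ^ p * single (p : ℤ) 1) *
          (expand B hp q' ^ p * expand B hp q ^ p) *
          (algebraMap ℂ (HahnSeries ℤ B) γ ^ p * algebraMap ℂ _ (-b)) := by ring
      _ = 1 := by rw [hs, hq'', hγb, one_mul, one_mul]
  have h2 := congrArg (expand B hp) hfU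
  rw [map_mul, map_one] at h2
  linear_combination expand B hp f * h1 - (single (-1) 1 * expand B hp (γ • q')) ^ p * h2

/-- A `p`-th root `T` of a solution of `f' = p c₁ f + p c f ^ 2` solves
`T' = c₁ T + c T ^ (p + 1)`, where the prime is `d/dx` and `y d/dy = p y ^ p d/dx`. -/
theorem eulerDerivation_root {p : ℕ} (hp : 0 < p) (f T : HahnSeries ℤ B) (c₁ c : ℂ)
    (hf : eulerDerivation B f = single 1 1 * ((p * c₁) • f + (p * c) • f ^ 2)) (hfu : IsUnit f)
    (hT : T ^ p = expand B hp f) :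
    eulerDerivation B T = (p : ℂ) • (single (p : ℤ) 1 * (c₁ • T + c • T ^ (p + 1))) := by
  have hTu : IsUnit T := by
    rw [← isUnit_pow_iff hp.ne', hT]
    exact hfu.map _
  have h := congrArg (eulerDerivation B) hT
  have hpu : IsUnit (algebraMap ℂ (HahnSeries ℤ B) p) :=
    (IsUnit.mk0 (p : ℂ) (by exact_mod_cast hp.ne')).map _
  rw [eulerDerivation_expand, hf, Derivation.leibniz_pow, map_mul, expand_single, map_add,
    map_smul, map_smul, map_pow, ← hT, ← Nat.cast_smul_eq_nsmul ℂ] at h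
  refine ((hpu.mul (hTu.pow (p - 1))).mul_right_inj).1 ?_
  obtain ⟨k, rfl⟩ := Nat.exists_eq_add_of_le' hp
  simp only [Nat.add_sub_cancel, smul_eq_mul, Algebra.smul_def, map_mul, mul_one] at h ⊢
  linear_combination h

end HahnSeries

/-! ### Vector fields on the line and the power map -/

theorem map_divPowZ {A A' : Type*} [CommRing A] [Algebra ℂ A] [CommRing A'] [Algebra ℂ A']
    {D : Derivation ℂ A A} {D' : Derivation ℂ A' A'} (f : A →ₐ[ℂ] A')
    (hf : ∀ a, f (D a) = D' (f a)) (j : ℤ) (a : A) :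
    f (divPowZ D j a) = divPowZ D' j (f a) := by
  have h : ∀ k : ℕ, f (((D : A →ₗ[ℂ] A) ^ k) a) = ((D' : A' →ₗ[ℂ] A') ^ k) (f a) := by
    intro k
    induction k with
    | zero => simp
    | succ k ih => simp [pow_succ', hf, ih]
  unfold divPowZ
  split_ifs
  · simp [divPow, h]
  · simp

theorem VertexAlgebra.isHom_of_commute {A A' : Type*} [CommRing A] [Algebra ℂ A] [CommRing A']
    [Algebra ℂ A'] {D : Derivation ℂ A A} {D' : Derivation ℂ A' A'} (f : A →ₐ[ℂ] A')
    (hf : ∀ a, f (D a) = D' (f a)) :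
    (VertexAlgebra.ofDerivation D).IsHom (VertexAlgebra.ofDerivation D') f.toLinearMap := by
  refine ⟨map_one f, fun n u v => ?_⟩
  change f (divPowZ D (-n - 1) u * v) = divPowZ D' (-n - 1) (f u) * f v
  rw [map_mul, map_divPowZ f hf]

namespace Polynomial

theorem polyDerivation_apply (f a : ℂ[X]) : polyDerivation f a = f * derivative a := rfl

/-- The vector field `(c₁ t + c t ^ (p + 1)) d/dt`. -/
noncomputable abbrev powDerivation (p : ℕ) (c₁ c : ℂ) : Derivation ℂ ℂ[X] ℂ[X] :=
  polyDerivation (C c₁ * X + C c * X ^ (p + 1))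

/-- The vector field which `powDerivation p c₁ c` induces on the line with coordinate `t ^ p`. -/
noncomputable abbrev quotientDerivation (p : ℕ) (c₁ c : ℂ) : Derivation ℂ ℂ[X] ℂ[X] :=
  polyDerivation (C (p * c₁) * X + C (p * c) * X ^ 2)

/-- The subalgebra `ℂ[t ^ p]`. -/
noncomputable abbrev powSubalgebra (p : ℕ) : Subalgebra ℂ ℂ[X] :=
  Algebra.adjoin ℂ {(X : ℂ[X]) ^ p}

theorem mem_powSubalgebra {p : ℕ} {a : ℂ[X]} :
    a ∈ powSubalgebra p ↔ ∃ q, expand ℂ p q = a := by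
  unfold powSubalgebra
  rw [Algebra.adjoin_singleton_eq_range_aeval]
  rfl

theorem powDerivation_expand {p : ℕ} (hp : 0 < p) (c₁ c : ℂ) (q : ℂ[X]) :
    powDerivation p c₁ c (expand ℂ p q) = expand ℂ p (quotientDerivation p c₁ c q) := by
  obtain ⟨k, rfl⟩ := Nat.exists_eq_add_of_le' hp
  simp only [polyDerivation_apply, derivative_expand, map_mul, map_add, expand_C, expand_X,
    map_pow, Nat.add_sub_cancel, map_natCast]
  ring

theorem powDerivation_mem {p : ℕ} (hp : 0 < p) (c₁ c : ℂ) :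
    ∀ a ∈ powSubalgebra p, powDerivation p c₁ c a ∈ powSubalgebra p := by
  intro a ha
  obtain ⟨q, rfl⟩ := mem_powSubalgebra.1 ha
  rw [powDerivation_expand hp]
  exact mem_powSubalgebra.2 ⟨_, rfl⟩

/-- The isomorphism `ℂ[t] ≃ ℂ[t ^ p]`, `t ↦ t ^ p`. -/
noncomputable def powEquiv {p : ℕ} (hp : 0 < p) : ℂ[X] ≃ₐ[ℂ] powSubalgebra p :=
  AlgEquiv.ofBijective ((expand ℂ p).codRestrict _ fun q => mem_powSubalgebra.2 ⟨q, rfl⟩) (by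
    constructor
    · intro q q' h
      exact expand_injective hp (congrArg Subtype.val h)
    · rintro ⟨a, ha⟩
      obtain ⟨q, hq⟩ := mem_powSubalgebra.1 ha
      exact ⟨q, Subtype.ext hq⟩)

theorem coe_powEquiv {p : ℕ} (hp : 0 < p) (q : ℂ[X]) :
    (powEquiv hp q : ℂ[X]) = expand ℂ p q := rfl

theorem restrictDerivation_powEquiv {p : ℕ} (hp : 0 < p) (c₁ c : ℂ)
    (hS : ∀ a ∈ powSubalgebra p, powDerivation p c₁ c a ∈ powSubalgebra p) (q : ℂ[X]) :
    restrictDerivation (powDerivation p c₁ c) (powSubalgebra p) hS (powEquiv hp q) =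
      powEquiv hp (quotientDerivation p c₁ c q) :=
  Subtype.ext (powDerivation_expand hp c₁ c q)

section Rotation

variable {p : ℕ} {g : ℂ[X] ≃ₐ[ℂ] ℂ[X]} {ξ : ℂ}

theorem rotation_apply (hξ : g X = C ξ * X) (a : ℂ[X]) : g a = a.comp (C ξ * X) := by
  have h : (g : ℂ[X] →ₐ[ℂ] ℂ[X]) = aeval (C ξ * X) := by
    ext1; simpa using hξ
  rw [comp_eq_aeval, ← h]
  rfl

theorem coeff_rotation (hξ : g X = C ξ * X) (a : ℂ[X]) (n : ℕ) :
    (g a).coeff n = ξ ^ n * a.coeff n := by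
  rw [rotation_apply hξ, comp_C_mul_X_coeff, mul_comm]

theorem isPrimitiveRoot_of_orderOf (hord : orderOf g = p) (hξ : g X = C ξ * X) :
    IsPrimitiveRoot ξ p := by
  have hpow : ∀ n : ℕ, (g ^ n) X = C (ξ ^ n) * X := by
    intro n
    induction n with
    | zero => simp
    | succ n ih =>
      rw [pow_succ', AlgEquiv.mul_apply, ih, map_mul, hξ, pow_succ, C_mul]
      have : g (C (ξ ^ n)) = C (ξ ^ n) := g.commutes _
      rw [this]
      ring
  constructor
  · have h := hpow p
    rw [← hord, pow_orderOf_eq_one, hord] at h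
    have := congrArg (fun a => coeff a 1) h
    simpa only [AlgEquiv.one_apply, coeff_C_mul, coeff_X_one, mul_one] using this.symm
  · intro l hl
    rw [← hord]
    apply orderOf_dvd_of_pow_eq_one
    have : ((g ^ l : ℂ[X] ≃ₐ[ℂ] ℂ[X]) : ℂ[X] →ₐ[ℂ] ℂ[X]) = AlgHom.id ℂ ℂ[X] := by
      ext1
      simpa [hl] using hpow l
    ext1 a
    exact congrArg (fun f : ℂ[X] →ₐ[ℂ] ℂ[X] => f a) this

theorem rotation_powDerivation (hξ : g X = C ξ * X) (hξp : ξ ^ p = 1) (c₁ c : ℂ) (a : ℂ[X]) :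
    g (powDerivation p c₁ c a) = powDerivation p c₁ c (g a) := by
  have h : (C ξ : ℂ[X]) ^ p = 1 := by rw [← C_pow, hξp, C_1]
  simp only [rotation_apply hξ, polyDerivation_apply, derivative_comp, mul_comp, add_comp, C_comp,
    pow_comp, X_comp, derivative_C_mul, derivative_X, mul_pow, pow_succ, h]
  ring

theorem rotation_eq_self_iff (hp : 0 < p) (hξ : g X = C ξ * X) (hprim : IsPrimitiveRoot ξ p)
    (a : ℂ[X]) : g a = a ↔ a ∈ powSubalgebra p := by
  constructor
  · intro h
    refine mem_powSubalgebra.2 ⟨contract p a, ?_⟩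
    ext n
    rw [coeff_expand hp]
    split_ifs with hn
    · rw [coeff_contract hp.ne', Nat.div_mul_cancel hn]
    · have h1 := congrArg (fun a => coeff a n) h
      simp only [coeff_rotation hξ] at h1
      by_contra h0
      exact hn (hprim.dvd_of_pow_eq_one n ((mul_eq_right₀ (Ne.symm h0)).1 h1))
  · intro h
    obtain ⟨q, rfl⟩ := mem_powSubalgebra.1 h
    ext n
    rw [coeff_rotation hξ, coeff_expand hp]
    split_ifs with hn
    · obtain ⟨k, rfl⟩ := hn
      rw [pow_mul, hprim.pow_eq_one, one_pow, one_mul]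
    · rw [mul_zero]

theorem dvd_of_rotation_eq_smul (hp : 0 < p) (hξ : g X = C ξ * X) (hprim : IsPrimitiveRoot ξ p)
    {r : ℕ} {a : ℂ[X]} (ha : g a = ξ ^ r • a) {n : ℕ} (hn : a.coeff n ≠ 0) : (p : ℤ) ∣ r - n := by
  have h := congrArg (fun a => coeff a n) ha
  simp only [coeff_rotation hξ, coeff_smul, smul_eq_mul] at h
  have h1 := mul_right_cancel₀ hn h
  have hξ0 : ξ ≠ 0 := hprim.ne_zero hp.ne'
  rw [← hprim.zpow_eq_one_iff_dvd, zpow_sub₀ hξ0, zpow_natCast, zpow_natCast, h1,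
    div_self (pow_ne_zero _ hξ0)]

end Rotation

end Polynomial

/-! ### Modules without poles -/

/-- If no `Y(a, x)` has a pole, then `a ↦ a_{-1}` is a representation of the associative
algebra. -/
theorem UntwistedModule.comesFromAssociative {A : Type*} [CommRing A] [Algebra ℂ A]
    {D : Derivation ℂ A A} {M : Type*} [AddCommGroup M] [Module ℂ M]
    (Y : UntwistedModule (VertexAlgebra.ofDerivation D) M)
    (hY : ∀ (a : A) (k : ℤ), 0 ≤ k → Y.mode k a = 0) : ComesFromAssociative Y := by
  have hmul : ∀ a b w, Y.mode (-1) (a * b) w = Y.mode (-1) a (Y.mode (-1) b w) := by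
    intro a b w
    rw [mode_mul, finsum_eq_single _ 0]
    · rw [hY a ((0 : ℕ) : ℤ) (by simp)]; simp
    · intro i hi
      rw [hY b (-1 + i) (by omega), hY a i (by omega)]; simp
  have hiter : ∀ (i : ℕ) (a : A) (w : M), Y.mode (-1) (D^[i] a) w =
      (i.factorial : ℂ) • Y.mode (-(i : ℤ) - 1) a w := by
    intro i
    induction i with
    | zero => intro a w; simp
    | succ i ih =>
      intro a w
      rw [Function.iterate_succ_apply, ih, mode_derivation, smul_smul, Nat.factorial_succ]
      push_cast
      congr 1
      · ring
      · ring_nf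
  refine ⟨AlgHom.ofLinearMap (Y.mode (-1)) ?_ ?_, fun a w => ⟨fun i => ?_, fun k hk => ?_⟩⟩
  · ext w
    rw [mode_one]
    simp
  · intro a b
    ext w
    exact hmul a b w
  · rw [AlgHom.ofLinearMap_apply, map_smul, LinearMap.smul_apply, hiter, smul_smul,
      inv_mul_cancel₀ (by exact_mod_cast i.factorial_ne_zero), one_smul]
  · rw [hY a k hk, LinearMap.zero_apply]

namespace Polynomial

open scoped IsMulCommutative

variable {p : ℕ} {c₁ c : ℂ} {M : Type*} [AddCommGroup M] [Module ℂ M] [FiniteDimensional ℂ M]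
  {hS : ∀ a ∈ powSubalgebra p, powDerivation p c₁ c a ∈ powSubalgebra p}

theorem eulerDerivation_seriesHom_X_pow (hp : 0 < p)
    (Y : UntwistedModule (VertexAlgebra.ofDerivation
      (restrictDerivation (powDerivation p c₁ c) (powSubalgebra p) hS)) M) :
    HahnSeries.eulerDerivation _ (Y.seriesHom (powEquiv hp X)) = HahnSeries.single 1 1 *
      ((p * c₁) • Y.seriesHom (powEquiv hp X) + (p * c) • Y.seriesHom (powEquiv hp X) ^ 2) := by
  have h : restrictDerivation (powDerivation p c₁ c) (powSubalgebra p) hS (powEquiv hp X) =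
      (p * c₁) • powEquiv hp X + (p * c) • powEquiv hp X ^ 2 := by
    rw [restrictDerivation_powEquiv, ← map_smul, ← map_pow, ← map_smul, ← map_add,
      polyDerivation_apply, derivative_X, mul_one, smul_eq_C_mul, smul_eq_C_mul]
  have h' := congrArg Y.seriesHom h
  simp only [map_add, map_smul, map_pow] at h'
  rw [← h']
  ext n : 2
  rw [HahnSeries.coeff_eulerDerivation, HahnSeries.coeff_single_one_mul,
    UntwistedModule.coeff_seriesHom_derivation]

theorem comesFromAssociative_of_coeff (hp : 0 < p)
    (Y : UntwistedModule (VertexAlgebra.ofDerivation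
      (restrictDerivation (powDerivation p c₁ c) (powSubalgebra p) hS)) M)
    (hY : ∀ n < 0, (Y.seriesHom (powEquiv hp X)).coeff n = 0) : ComesFromAssociative Y := by
  have h : ∀ (q : ℂ[X]), ∀ n < 0, (Y.seriesHom (powEquiv hp q)).coeff n = 0 := by
    intro q
    induction q using Polynomial.induction_on' with
    | add q q' h h' =>
      intro n hn
      rw [map_add, map_add, HahnSeries.coeff_add, h n hn, h' n hn, add_zero]
    | monomial k z =>
      rw [← C_mul_X_pow_eq_monomial, ← smul_eq_C_mul, map_smul, map_smul]
      intro n hn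
      rw [HahnSeries.coeff_smul]
      suffices (Y.seriesHom (powEquiv hp (X ^ k))).coeff n = 0 by rw [this, smul_zero]
      induction k generalizing n with
      | zero =>
        rw [pow_zero, map_one, map_one, HahnSeries.coeff_one, if_neg hn.ne]
      | succ k ih =>
        rw [pow_succ, map_mul, map_mul, HahnSeries.coeff_mul]
        refine Finset.sum_eq_zero fun ij hij => ?_
        rw [Finset.mem_antidiagonal] at hij
        rcases lt_or_ge ij.1 0 with h | h
        · rw [ih _ h, zero_mul]
        · rw [hY _ (by omega), mul_zero]
  refine Y.comesFromAssociative fun a k hk => ?_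
  obtain ⟨q, rfl⟩ := (powEquiv hp).surjective a
  have := congrArg Subtype.val (h q (-k - 1) (by omega))
  rw [UntwistedModule.coe_coeff_seriesHom, show -(-k - 1) - 1 = k by ring] at this
  exact this

/-- Let `Y(a, x)`, for `a` in `ℂ[t ^ p]`, be given by the series `ρ a`. If `T(y) = y⁻¹ s(y ^ p)`
solves `T(y) ^ p = Y(t ^ p, x)` with `x = y ^ p`, then `Y(t, x) = T(y)` extends the action of
`ℂ[t ^ p]` on `M` to a twisted action of `ℂ[t]`. -/
theorem exists_twistedModule_of_root {M : Type*} [AddCommGroup M] [Module ℂ M] {B : Type*}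
    [CommRing B] [Algebra ℂ B] (hp : 0 < p) {g : ℂ[X] ≃ₐ[ℂ] ℂ[X]} {ξ : ℂ}
    (hξ : g X = C ξ * X) (hprim : IsPrimitiveRoot ξ p)
    (Y : UntwistedModule (VertexAlgebra.ofDerivation
      (restrictDerivation (powDerivation p c₁ c) (powSubalgebra p) hS)) M)
    (ρ : powSubalgebra p →ₐ[ℂ] HahnSeries ℤ B) (π : B →ₐ[ℂ] Module.End ℂ M)
    (hρ : ∀ k a w, Y.mode k a w = π ((ρ a).coeff (-k - 1)) w)
    (hθρ : HahnSeries.eulerDerivation B (ρ (powEquiv hp X)) = HahnSeries.single 1 1 *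
      ((p * c₁) • ρ (powEquiv hp X) + (p * c) • ρ (powEquiv hp X) ^ 2))
    (hu : IsUnit (ρ (powEquiv hp X))) (s : HahnSeries ℤ B)
    (hs : (HahnSeries.single (-1) 1 * HahnSeries.expand B hp s) ^ p =
      HahnSeries.expand B hp (ρ (powEquiv hp X))) :
    ∃ Z : TwistedModule (VertexAlgebra.ofDerivation (powDerivation p c₁ c)) g.toLinearMap p ξ M,
      IsRestrictionHom (powSubalgebra p).val.toLinearMap Y Z LinearMap.id := by
  set T := HahnSeries.single (-1) 1 * HahnSeries.expand B hp s with hT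
  have hθT := HahnSeries.eulerDerivation_root hp _ T c₁ c hθρ hu hs
  have hθ : ∀ a : ℂ[X], HahnSeries.eulerDerivation B (aeval T a) =
      (p : ℂ) • (HahnSeries.single (p : ℤ) 1 * aeval T (powDerivation p c₁ c a)) := by
    intro a
    rw [Derivation.map_aeval, hθT, polyDerivation_apply, map_mul, map_add, map_mul, map_mul,
      aeval_C, aeval_C, map_pow, aeval_X, smul_eq_mul, mul_smul_comm]
    simp only [Algebra.smul_def]
    ring
  have hpow : ∀ n : ℕ, T ^ n = HahnSeries.single (-n : ℤ) 1 * HahnSeries.expand B hp (s ^ n) := by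
    intro n
    rw [hT, mul_pow, HahnSeries.single_pow, map_pow (HahnSeries.expand B hp)]
    simp
  have hext : ∀ a : powSubalgebra p, aeval T (a : ℂ[X]) = HahnSeries.expand B hp (ρ a) := by
    intro a
    obtain ⟨q, rfl⟩ := (powEquiv hp).surjective a
    have : (aeval T).comp (expand ℂ p) = ((HahnSeries.expand B hp).comp ρ).comp
        (powEquiv hp : ℂ[X] →ₐ[ℂ] powSubalgebra p) := by
      apply algHom_ext
      simpa using hs
    exact congrArg (fun f : ℂ[X] →ₐ[ℂ] _ => f q) this
  refine ⟨TwistedModule.ofLaurent hp g.toLinearMap ξ (aeval T) π ?_ ?_, ?_⟩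
  · intro a n
    have := congrArg (fun f => f.coeff n) (hθ a)
    simpa only [HahnSeries.coeff_eulerDerivation, HahnSeries.coeff_smul,
      HahnSeries.coeff_single_one_mul] using this
  · intro r a ha k hk
    rw [aeval_eq_sum_range, HahnSeries.coeff_sum] at hk
    obtain ⟨n, -, hn⟩ := Finset.exists_ne_zero_of_sum_ne_zero hk
    rw [HahnSeries.coeff_smul, hpow, HahnSeries.coeff_single_one_mul] at hn
    have h1 : (p : ℤ) ∣ k - -n := by
      by_contra h
      exact hn (by rw [HahnSeries.coeff_expand_of_not_dvd hp _ h, smul_zero])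
    have h2 := dvd_of_rotation_eq_smul hp hξ hprim ha
      (fun h => hn (by rw [h, zero_smul]) : a.coeff n ≠ 0)
    have := dvd_add h1 h2
    rwa [show k - -(n : ℤ) + (r - n) = k + r by ring] at this
  · intro a w
    refine ⟨fun k => ?_, fun k hk => ?_⟩
    · change π ((aeval T (a : ℂ[X])).coeff (-(p * k) - p)) w = Y.mode k a w
      rw [hext, show -(p * k : ℤ) - p = p * (-k - 1) by ring, HahnSeries.coeff_expand_mul, hρ]
    · change π ((aeval T (a : ℂ[X])).coeff (-k - p)) w = 0
      rw [hext, HahnSeries.coeff_expand_of_not_dvd hp, map_zero, LinearMap.zero_apply]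
      intro h
      apply hk
      have := dvd_add h (dvd_refl (p : ℤ))
      rwa [sub_add_cancel, dvd_neg] at this

/-- An indecomposable `(ℂ[t ^ p], D)`-module not coming from the associative algebra carries a
structure of an indecomposable twisted `(ℂ[t], D)`-module. -/
theorem exists_twistedModule (hp : 0 < p) {g : ℂ[X] ≃ₐ[ℂ] ℂ[X]} {ξ : ℂ}
    (hξ : g X = C ξ * X) (hprim : IsPrimitiveRoot ξ p)
    (Y : UntwistedModule (VertexAlgebra.ofDerivation
      (restrictDerivation (powDerivation p c₁ c) (powSubalgebra p) hS)) M)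
    (hY : Y.IsIndecomposable) (hna : ¬ ComesFromAssociative Y) :
    ∃ Z : TwistedModule (VertexAlgebra.ofDerivation (powDerivation p c₁ c)) g.toLinearMap p ξ M,
      Z.IsIndecomposable ∧ IsRestrictionHom (powSubalgebra p).val.toLinearMap Y Z LinearMap.id := by
  have := hY.1
  have : IsArtinianRing Y.modeAlgebra := IsArtinianRing.of_finite ℂ _
  have : Nontrivial Y.modeAlgebra := inferInstance
  rcases HahnSeries.riccati_dichotomy (UntwistedModule.isUnit_or_isNilpotent Y hY) _ _ _
    (eulerDerivation_seriesHom_X_pow hp Y) with h | ⟨U, hU, hU', hreg, h0⟩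
  · exact absurd (comesFromAssociative_of_coeff hp Y h) hna
  obtain ⟨s, hs⟩ := HahnSeries.exists_root_of_riccati hp _ U _ _ hU hU' hreg h0
  obtain ⟨Z, hZ⟩ := exists_twistedModule_of_root hp hξ hprim Y Y.seriesHom Y.modeAlgebra.val
    (fun k a w => by
      rw [Subalgebra.val_apply, UntwistedModule.coe_coeff_seriesHom,
        show -(-k - 1) - 1 = k by ring])
    (eulerDerivation_seriesHom_X_pow hp Y) (IsUnit.of_mul_eq_one U hU) s hs
  refine ⟨Z, ⟨hY.1, fun N₁ N₂ h₁ h₂ h => ?_⟩, hZ⟩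
  have hsub : ∀ N : Submodule ℂ M, Z.IsSubmodule N → Y.IsSubmodule N := fun N hN k a w hw => by
    have := (hZ a w).1 k
    rw [LinearMap.id_apply, LinearMap.id_apply] at this
    rw [← this]
    exact hN _ _ w hw
  exact hY.2 N₁ N₂ (hsub _ h₁) (hsub _ h₂) h

end Polynomial

/-! ### Modules of an algebra with a derivation -/

section Associative

variable {A : Type*} [CommRing A] [Algebra ℂ A]

theorem divPow_derivation (D : Derivation ℂ A A) (k : ℕ) (a : A) :
    divPow D k (D a) = ((k : ℂ) + 1) • divPow D (k + 1) a := by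
  rw [succ_smul_divPow_succ]
  simp only [divPow, LinearMap.smul_apply, Derivation.map_smul]
  congr 1
  have h := congrArg (fun f => f a) (pow_succ (D : A →ₗ[ℂ] A) k)
  rw [pow_succ'] at h
  exact h.symm

/-- The Taylor expansion `a ↦ ∑ (D ^ i a / i!) x ^ i`. -/
noncomputable def taylorHom (D : Derivation ℂ A A) : A →ₐ[ℂ] HahnSeries ℤ A :=
  AlgHom.ofLinearMap
    { toFun := fun a => HahnSeries.ofPowerSeries ℤ A (PowerSeries.mk fun n => divPow D n a)
      map_add' := fun a b => by
        rw [← map_add]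
        congr 1
        ext n
        simp
      map_smul' := fun c a => by
        ext n
        rw [RingHom.id_apply, HahnSeries.coeff_smul, PowerSeries.coeff_coe, PowerSeries.coeff_coe]
        split_ifs <;> simp }
    (by
      change HahnSeries.ofPowerSeries ℤ A _ = 1
      rw [← map_one (HahnSeries.ofPowerSeries ℤ A)]
      congr 1
      ext n
      rw [PowerSeries.coeff_mk, PowerSeries.coeff_one]
      cases n <;> simp [divPow, pow_succ])
    (fun a b => by
      change HahnSeries.ofPowerSeries ℤ A _ =
        HahnSeries.ofPowerSeries ℤ A _ * HahnSeries.ofPowerSeries ℤ A _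
      rw [← map_mul]
      congr 1
      ext n
      rw [PowerSeries.coeff_mk, PowerSeries.coeff_mul, divPow_mul]
      simp)

theorem coeff_taylorHom (D : Derivation ℂ A A) (a : A) (n : ℤ) :
    (taylorHom D a).coeff n = divPowZ D n a := by
  change (HahnSeries.ofPowerSeries ℤ A _).coeff n = _
  rw [PowerSeries.coeff_coe]
  rcases lt_or_ge n 0 with hn | hn
  · rw [if_pos hn, divPowZ_neg D hn, LinearMap.zero_apply]
  · lift n to ℕ using hn
    rw [if_neg (by omega), divPowZ_natCast, PowerSeries.coeff_mk, Int.natAbs_natCast]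

/-- A module `W` for the associative algebra `A` is a module for the vertex algebra `(A, D)`. -/
noncomputable def UntwistedModule.ofAssociative (D : Derivation ℂ A A) {W : Type*}
    [AddCommGroup W] [Module ℂ W] (π : A →ₐ[ℂ] Module.End ℂ W) :
    UntwistedModule (VertexAlgebra.ofDerivation D) W :=
  TwistedModule.ofLaurent one_pos LinearMap.id 1 (taylorHom D) π
    (fun a n => by
      rw [coeff_taylorHom, coeff_taylorHom, Nat.cast_one, Nat.cast_one, one_smul]
      rcases lt_trichotomy n 0 with hn | rfl | hn
      · rw [divPowZ_neg D hn, divPowZ_neg D (by omega)]; simp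
      · rw [divPowZ_neg D (j := 0 - 1) (by omega)]; simp
      · obtain ⟨k, rfl⟩ : ∃ k : ℕ, n = (k + 1 : ℕ) := ⟨n.natAbs - 1, by omega⟩
        rw [show ((k + 1 : ℕ) : ℤ) - 1 = k by push_cast; ring, divPowZ_natCast, divPowZ_natCast,
          divPow_derivation]
        push_cast
        rfl)
    (fun r u _ k _ => by simp)

theorem UntwistedModule.ofAssociative_mode (D : Derivation ℂ A A) {W : Type*}
    [AddCommGroup W] [Module ℂ W] (π : A →ₐ[ℂ] Module.End ℂ W) (k : ℤ) (a : A) (w : W) :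
    (ofAssociative D π).mode k a w = π (divPowZ D (-k - 1) a) w := by
  change π ((taylorHom D a).coeff (-k - (1 : ℕ))) w = _
  rw [coeff_taylorHom, Nat.cast_one]

theorem divPow_eq_iterate (D : Derivation ℂ A A) (i : ℕ) (a : A) :
    divPow D i a = ((i.factorial : ℂ)⁻¹) • D^[i] a := by
  simp [divPow, Module.End.pow_apply]

theorem UntwistedModule.comesFromAssociative_ofAssociative (D : Derivation ℂ A A) {W : Type*}
    [AddCommGroup W] [Module ℂ W] (π : A →ₐ[ℂ] Module.End ℂ W) :
    ComesFromAssociative (ofAssociative D π) := by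
  refine ⟨π, fun a w => ⟨fun i => ?_, fun k hk => ?_⟩⟩
  · rw [ofAssociative_mode, show -(-(i : ℤ) - 1) - 1 = i by ring, divPowZ_natCast,
      divPow_eq_iterate]
  · rw [ofAssociative_mode, divPowZ_neg D (by omega)]; simp

theorem UntwistedModule.mode_eq_of_comesFromAssociative {D : Derivation ℂ A A} {M : Type*}
    [AddCommGroup M] [Module ℂ M] {Y : UntwistedModule (VertexAlgebra.ofDerivation D) M}
    {ρ : A →ₐ[ℂ] Module.End ℂ M}
    (hρ : ∀ (a : A) (w : M),
      (∀ i : ℕ, Y.mode (-(i : ℤ) - 1) a w = ρ (((i.factorial : ℂ)⁻¹) • D^[i] a) w) ∧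
      (∀ k : ℤ, 0 ≤ k → Y.mode k a w = 0)) (k : ℤ) (a : A) (w : M) :
    Y.mode k a w = ρ (divPowZ D (-k - 1) a) w := by
  rcases lt_or_ge k 0 with hk | hk
  · obtain ⟨i, rfl⟩ : ∃ i : ℕ, k = -(i : ℤ) - 1 := ⟨k.natAbs - 1, by omega⟩
    rw [(hρ a w).1, show -(-(i : ℤ) - 1) - 1 = i by ring, divPowZ_natCast, divPow_eq_iterate]
  · rw [(hρ a w).2 k hk, divPowZ_neg D (by omega)]; simp

end Associative

/-! ### Indecomposable `ℂ[t]`-modules -/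

namespace Polynomial

open scoped DirectSum

/-- A finite-dimensional `ℂ[t]`-module without nontrivial direct summands is cyclic, with
annihilator generated by a power of some `t - a`. -/
theorem exists_cyclic_of_indecomposable {M : Type*} [AddCommGroup M] [Module ℂ M]
    [FiniteDimensional ℂ M] [Nontrivial M] (f : Module.End ℂ M)
    (hf : ∀ N₁ N₂ : Submodule ℂ M, (∀ w ∈ N₁, f w ∈ N₁) → (∀ w ∈ N₂, f w ∈ N₂) → IsCompl N₁ N₂ →
      N₁ = ⊥ ∨ N₂ = ⊥) :
    ∃ (a : ℂ) (m : ℕ) (v : M), m ≠ 0 ∧ (∀ w, ∃ q : ℂ[X], aeval f q v = w) ∧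
      ∀ q : ℂ[X], aeval f q v = 0 ↔ (X - C a) ^ m ∣ q := by
  obtain ⟨ι, _, h, hirr, e, ⟨E⟩⟩ := Module.equiv_directSum_of_isTorsion
    (Module.AEval.isTorsion_of_finiteDimensional ℂ M f)
  classical
  let θ := Module.AEval'.of f
  have hθ : ∀ (q : ℂ[X]) (w : M), θ (aeval f q w) = q • θ w := fun q w =>
    Module.AEval.of_aeval_smul f q w
  have hX : ∀ w : M, θ (f w) = (X : ℂ[X]) • θ w := fun w => by simpa using hθ X w
  obtain ⟨i, hi⟩ : ∃ i, ∃ y : ℂ[X] ⧸ (ℂ[X] ∙ h i ^ e i), y ≠ 0 := by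
    obtain ⟨w, hw⟩ := exists_ne (0 : M)
    by_contra hc
    push Not at hc
    apply hw
    apply θ.injective
    apply E.injective
    rw [map_zero, map_zero]
    ext i
    exact hc i _
  -- the projection of `M` to its summand with index `i`
  let P : M →ₗ[ℂ] M := θ.symm.toLinearMap ∘ₗ (E.symm.toLinearMap ∘ₗ
    DirectSum.lof ℂ[X] ι (fun i => ℂ[X] ⧸ (ℂ[X] ∙ h i ^ e i)) i ∘ₗ
    DirectSum.component ℂ[X] ι (fun i => ℂ[X] ⧸ (ℂ[X] ∙ h i ^ e i)) i ∘ₗ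
    E.toLinearMap).restrictScalars ℂ ∘ₗ θ.toLinearMap
  have hP : ∀ w, P w = θ.symm (E.symm (DirectSum.lof ℂ[X] ι _ i (E (θ w) i))) := fun w => rfl
  have hPf : ∀ w, P (f w) = f (P w) := fun w => by
    apply θ.injective
    rw [hX, hP, hP, hX, LinearEquiv.apply_symm_apply, LinearEquiv.apply_symm_apply, map_smul,
      DirectSum.smul_apply, map_smul, map_smul]
  have hPP : IsIdempotentElem P := by
    ext w
    rw [Module.End.mul_apply, hP, hP, LinearEquiv.apply_symm_apply, LinearEquiv.apply_symm_apply,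
      DirectSum.lof_apply]
  have hker : LinearMap.ker P = ⊥ := by
    refine (hf _ _ ?_ ?_ (LinearMap.IsIdempotentElem.isCompl hPP)).resolve_left ?_
    · rintro _ ⟨w, rfl⟩
      exact ⟨f w, hPf w⟩
    · intro w hw
      rw [LinearMap.mem_ker] at hw ⊢
      rw [hPf, hw, map_zero]
    · intro h0
      obtain ⟨y, hy⟩ := hi
      apply hy
      have h1 := LinearMap.congr_fun (LinearMap.range_eq_bot.1 h0)
        (θ.symm (E.symm (DirectSum.lof ℂ[X] ι _ i y)))
      rw [hP, LinearEquiv.apply_symm_apply, LinearEquiv.apply_symm_apply, DirectSum.lof_apply,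
        LinearMap.zero_apply, map_eq_zero_iff _ θ.symm.injective,
        map_eq_zero_iff _ E.symm.injective] at h1
      have h2 := congrArg (fun z => z i) h1
      simpa only [DirectSum.lof_apply, DirectSum.zero_apply] using h2
  have hPid : ∀ w, P w = w := fun w => LinearMap.ker_eq_bot.1 hker (LinearMap.congr_fun hPP w)
  let v : M := θ.symm (E.symm (DirectSum.lof ℂ[X] ι _ i (Submodule.Quotient.mk 1)))
  have hv : ∀ q : ℂ[X], aeval f q v =
      θ.symm (E.symm (DirectSum.lof ℂ[X] ι _ i (Submodule.Quotient.mk q))) := fun q => by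
    apply θ.injective
    rw [hθ, LinearEquiv.apply_symm_apply, LinearEquiv.apply_symm_apply, ← map_smul, ← map_smul,
      ← Submodule.Quotient.mk_smul, smul_eq_mul, mul_one]
  have hinj : Function.Injective
      (DirectSum.lof ℂ[X] ι (fun i => ℂ[X] ⧸ (ℂ[X] ∙ h i ^ e i)) i) :=
    fun y y' hy => by
      have := congrArg (fun z => z i) hy
      simpa only [DirectSum.lof_apply] using this
  have hzero : ∀ q : ℂ[X], aeval f q v = 0 ↔ h i ^ e i ∣ q := fun q => by
    rw [hv, map_eq_zero_iff _ θ.symm.injective, map_eq_zero_iff _ E.symm.injective,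
      map_eq_zero_iff _ hinj, Submodule.Quotient.mk_eq_zero]
    exact Ideal.mem_span_singleton
  obtain ⟨a, ha⟩ := IsAlgClosed.exists_root (h i) (hirr i).degree_pos.ne'
  have hassoc : Associated (X - C a) (h i) :=
    (irreducible_X_sub_C a).associated_of_dvd (hirr i) (dvd_iff_isRoot.2 ha)
  have hsurj : ∀ w, ∃ q : ℂ[X], aeval f q v = w := fun w => by
    obtain ⟨q, hq⟩ := Submodule.Quotient.mk_surjective _ (E (θ w) i)
    exact ⟨q, by rw [hv, hq, ← hP, hPid]⟩
  refine ⟨a, e i, v, fun h0 => ?_, hsurj, fun q => ?_⟩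
  · obtain ⟨w, hw⟩ := exists_ne (0 : M)
    obtain ⟨q, rfl⟩ := hsurj w
    exact hw ((hzero q).2 (by rw [h0, pow_zero]; exact one_dvd q))
  · rw [hzero, hassoc.pow_pow.dvd_iff_dvd_left]

/-- The exponent `e` is the multiplicity of `b` as a root of `t ^ p - a`. -/
theorem pow_dvd_expand_iff {p : ℕ} (hp : 0 < p) {a b : ℂ} (hb : b ^ p = a) :
    ∃ e : ℕ, e ≠ 0 ∧ ∀ (m : ℕ) (q : ℂ[X]),
      (X - C b) ^ (e * m) ∣ expand ℂ p q ↔ (X - C a) ^ m ∣ q := by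
  have hne : expand ℂ p (X - C a) ≠ 0 := by
    rw [Ne, expand_eq_zero hp]; exact X_sub_C_ne_zero a
  obtain ⟨h, hh, hdvd⟩ := exists_eq_pow_rootMultiplicity_mul_and_not_dvd _ hne b
  set e := rootMultiplicity b (expand ℂ p (X - C a)) with he
  have he0 : e ≠ 0 := by
    have : 0 < e := (rootMultiplicity_pos hne).2 (by simp [IsRoot, hb])
    omega
  refine ⟨e, he0, fun m q => ⟨fun hq => ?_, ?_⟩⟩
  · rcases eq_or_ne q 0 with rfl | hq0
    · exact dvd_zero _
    obtain ⟨q₁, hq₁, hq₁'⟩ := exists_eq_pow_rootMultiplicity_mul_and_not_dvd q hq0 a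
    set j := rootMultiplicity a q with hj
    by_contra hc
    have hjm : j < m := by
      by_contra hmj
      exact hc (by rw [hq₁]; exact (pow_dvd_pow _ (by omega)).mul_right _)
    have h1 : (X - C b) ^ (e * j) * (X - C b) ∣
        (X - C b) ^ (e * j) * (h ^ j * expand ℂ p q₁) := by
      have h2 : (X - C b) ^ (e * j) * (X - C b) ∣ (X - C b) ^ (e * m) := by
        rw [← pow_succ]
        apply pow_dvd_pow
        have : e * (j + 1) ≤ e * m := Nat.mul_le_mul_left e hjm
        have : e * (j + 1) = e * j + e := by ring
        omega
      refine (h2.trans hq).trans (dvd_of_eq ?_)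
      conv_lhs => rw [hq₁, map_mul, map_pow, hh]
      ring
    have h3 := (mul_dvd_mul_iff_left (pow_ne_zero _ (X_sub_C_ne_zero b))).1 h1
    rcases (prime_X_sub_C b).dvd_or_dvd h3 with h4 | h4
    · exact hdvd ((prime_X_sub_C b).dvd_of_dvd_pow h4)
    · apply hq₁'
      rw [dvd_iff_isRoot, IsRoot.def] at h4 ⊢
      rwa [expand_eval, hb] at h4
  · rintro ⟨q₁, rfl⟩
    rw [map_mul, map_pow, hh, mul_pow, ← pow_mul, mul_assoc]
    exact dvd_mul_right _ _

/-- The module `ℂ[t] / (t - b) ^ k`, in an arbitrary universe. -/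
abbrev LocalQuotient (b : ℂ) (k : ℕ) : Type u :=
  ULift.{u} (ℂ[X] ⧸ Ideal.span {(X - C b) ^ k})

/-- If `1` is a sum of elements of two submodules, one of the summands is invertible. -/
theorem isIndecomposable_localQuotient (D : Derivation ℂ ℂ[X] ℂ[X]) (b : ℂ) {k : ℕ}
    (hk : k ≠ 0) :
    (UntwistedModule.ofAssociative D
      (Algebra.lsmul ℂ ℂ (LocalQuotient.{u} b k))).IsIndecomposable := by
  set mk : ℂ[X] → LocalQuotient.{u} b k := fun q => ULift.up (Ideal.Quotient.mk _ q) with hmk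
  have hmk_eq : ∀ q q', mk q = mk q' ↔ (X - C b) ^ k ∣ q - q' := fun q q' => by
    rw [hmk, ULift.up_inj, Ideal.Quotient.eq, Ideal.mem_span_singleton]
  have hmk_surj : Function.Surjective mk := fun w => by
    obtain ⟨q, hq⟩ := Ideal.Quotient.mk_surjective w.down
    exact ⟨q, ULift.ext _ _ hq⟩
  have hsmul : ∀ q q', q • mk q' = mk (q * q') := fun q q' => rfl
  have hadd : ∀ q q', mk q + mk q' = mk (q + q') := fun q q' => rfl
  have heval : ∀ q q', mk q = mk q' → q.eval b = q'.eval b := fun q q' h => by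
    have h1 := (dvd_pow_self _ hk).trans ((hmk_eq q q').1 h)
    rw [dvd_iff_isRoot, IsRoot.def, eval_sub, sub_eq_zero] at h1
    exact h1
  constructor
  · refine ⟨⟨mk 0, mk 1, fun h => ?_⟩⟩
    simpa using heval _ _ h
  intro N₁ N₂ h₁ h₂ h
  have hstable : ∀ N : Submodule ℂ (LocalQuotient.{u} b k),
      (UntwistedModule.ofAssociative D (Algebra.lsmul ℂ ℂ (LocalQuotient.{u} b k))).IsSubmodule N →
      ∀ (q : ℂ[X]), ∀ w ∈ N, q • w ∈ N := fun N hN q w hw => by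
    have := hN (-1) q w hw
    rw [UntwistedModule.ofAssociative_mode] at this
    simpa [divPowZ, divPow] using this
  -- a submodule with an element which does not vanish at `b` contains `1`
  have htop : ∀ N : Submodule ℂ (LocalQuotient.{u} b k),
      (∀ (q : ℂ[X]), ∀ w ∈ N, q • w ∈ N) → ∀ q, mk q ∈ N → q.eval b ≠ 0 → N = ⊤ := by
    intro N hN q hq hqb
    have hcop : IsCoprime q ((X - C b) ^ k) := by
      refine IsCoprime.pow_right (IsCoprime.symm ?_)
      rw [(irreducible_X_sub_C b).coprime_iff_not_dvd, dvd_iff_isRoot]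
      exact hqb
    obtain ⟨r, r', hr⟩ := hcop
    rw [eq_top_iff]
    intro w _
    obtain ⟨w, rfl⟩ := hmk_surj w
    have : mk w = (w * r) • mk q := by
      rw [hsmul, hmk_eq]
      exact ⟨w * r', by linear_combination (-w) * hr⟩
    rw [this]
    exact hN _ _ hq
  obtain ⟨w₁, hw₁, w₂, hw₂, hw⟩ := Submodule.mem_sup.1
    (h.sup_eq_top ▸ Submodule.mem_top : mk 1 ∈ N₁ ⊔ N₂)
  obtain ⟨q₁, rfl⟩ := hmk_surj w₁
  obtain ⟨q₂, rfl⟩ := hmk_surj w₂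
  rw [hadd] at hw
  have hev := heval _ _ hw
  rw [eval_add, eval_one] at hev
  by_cases h0 : q₁.eval b = 0
  · left
    have := htop N₂ (hstable _ h₂) q₂ hw₂ (by rw [h0, zero_add] at hev; rw [hev]; exact one_ne_zero)
    rw [this] at h
    exact eq_bot_of_isCompl_top h
  · right
    have := htop N₁ (hstable _ h₁) q₁ hw₁ h0
    rw [this] at h
    exact eq_bot_of_top_isCompl h

/-- An indecomposable module coming from `ℂ[t ^ p]` embeds into `ℂ[t] / (t - b) ^ k` for suitable
`b` and `k`. -/
theorem exists_associativeModule {p : ℕ} (hp : 0 < p) {c₁ c : ℂ} {M : Type u} [AddCommGroup M]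
    [Module ℂ M] [FiniteDimensional ℂ M]
    {hS : ∀ a ∈ powSubalgebra p, powDerivation p c₁ c a ∈ powSubalgebra p}
    (Y : UntwistedModule (VertexAlgebra.ofDerivation
      (restrictDerivation (powDerivation p c₁ c) (powSubalgebra p) hS)) M)
    (hY : Y.IsIndecomposable) (ha : ComesFromAssociative Y) :
    ∃ (W : Type u) (_ : AddCommGroup W) (_ : Module ℂ W) (_ : FiniteDimensional ℂ W)
      (Z : UntwistedModule (VertexAlgebra.ofDerivation (powDerivation p c₁ c)) W)
      (φ : M →ₗ[ℂ] W), Z.IsIndecomposable ∧ ComesFromAssociative Z ∧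
        Function.Injective φ ∧ IsRestrictionHom (powSubalgebra p).val.toLinearMap Y Z φ := by
  obtain ⟨ρ, hρ⟩ := ha
  have hmode := UntwistedModule.mode_eq_of_comesFromAssociative hρ
  have := hY.1
  set f := ρ (powEquiv hp X) with hf
  have hρf : ∀ q : ℂ[X], ρ (powEquiv hp q) = aeval f q := fun q => by
    have : ρ.comp (powEquiv hp : ℂ[X] →ₐ[ℂ] powSubalgebra p) = aeval f := by
      apply algHom_ext
      simp [hf]
    exact congrArg (fun f : ℂ[X] →ₐ[ℂ] _ => f q) this
  have hsub : ∀ N : Submodule ℂ M, (∀ w ∈ N, f w ∈ N) → Y.IsSubmodule N := by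
    intro N hN k a w hw
    obtain ⟨q, hq⟩ := (powEquiv hp).surjective
      (divPowZ (restrictDerivation (powDerivation p c₁ c) (powSubalgebra p) hS) (-k - 1) a)
    rw [hmode, ← hq, hρf]
    have hpow : ∀ n, (f ^ n) w ∈ N := by
      intro n
      induction n with
      | zero => exact hw
      | succ n ih => rw [pow_succ']; exact hN _ ih
    rw [aeval_eq_sum_range, LinearMap.sum_apply]
    exact N.sum_mem fun n _ => N.smul_mem _ (hpow n)
  obtain ⟨a, m, v, hm, hsurj, hzero⟩ := exists_cyclic_of_indecomposable f
    fun N₁ N₂ h₁ h₂ h => hY.2 N₁ N₂ (hsub _ h₁) (hsub _ h₂) h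
  obtain ⟨b, hb⟩ := IsAlgClosed.exists_pow_nat_eq a hp
  obtain ⟨e, he, hdvd⟩ := pow_dvd_expand_iff hp hb
  -- `M` is the quotient of `ℂ[t]` by the kernel of `χ`, which is also the kernel of `ψ`
  let χ : ℂ[X] →ₗ[ℂ] M := LinearMap.applyₗ v ∘ₗ (aeval f).toLinearMap
  let ψ : ℂ[X] →ₗ[ℂ] LocalQuotient.{u} b (e * m) := ULift.moduleEquiv.symm.toLinearMap ∘ₗ
    (Ideal.Quotient.mkₐ ℂ _).toLinearMap ∘ₗ (expand ℂ p).toLinearMap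
  have hψ : ∀ q, ψ q = ULift.up (Ideal.Quotient.mk _ (expand ℂ p q)) := fun q => rfl
  have hker : ∀ q, χ q = 0 ↔ ψ q = 0 := fun q => by
    rw [hψ, ULift.ext_iff, ULift.zero_down, Ideal.Quotient.eq_zero_iff_mem,
      Ideal.mem_span_singleton, hdvd]
    exact hzero q
  obtain ⟨r, hr⟩ := χ.exists_rightInverse_of_surjective (LinearMap.range_eq_top.2 hsurj)
  have hr' : ∀ w, χ (r w) = w := fun w => LinearMap.congr_fun hr w
  have hφ : ∀ q, (ψ ∘ₗ r) (χ q) = ψ q := fun q => by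
    rw [LinearMap.comp_apply, ← sub_eq_zero, ← map_sub, ← hker, map_sub, hr', sub_self]
  have : Module.Finite ℂ (ℂ[X] ⧸ Ideal.span {(X - C b) ^ (e * m)}) :=
    ((monic_X_sub_C b).pow _).finite_quotient
  refine ⟨LocalQuotient.{u} b (e * m), inferInstance, inferInstance, inferInstance,
    UntwistedModule.ofAssociative _ (Algebra.lsmul ℂ ℂ _), ψ ∘ₗ r,
    isIndecomposable_localQuotient _ b (Nat.mul_ne_zero he hm),
    UntwistedModule.comesFromAssociative_ofAssociative _ _, ?_, ?_⟩
  · rw [← LinearMap.ker_eq_bot, LinearMap.ker_eq_bot']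
    intro w hw
    rw [← hr' w, hker]
    exact hw
  · have hcomm : ∀ (s : powSubalgebra p) (w : M), (ψ ∘ₗ r) (ρ s w) = (s : ℂ[X]) • (ψ ∘ₗ r) w := by
      intro s w
      obtain ⟨q, rfl⟩ := (powEquiv hp).surjective s
      obtain ⟨q', rfl⟩ : ∃ q', χ q' = w := hsurj w
      have : ρ (powEquiv hp q) (χ q') = χ (q * q') := by
        rw [hρf]
        simp [χ]
      rw [this, hφ, hφ, hψ, hψ, map_mul, coe_powEquiv]
      rfl
    intro s w
    refine ⟨fun k => ?_, fun k hk => absurd (by simp) hk⟩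
    have hdiv := map_divPowZ (D := restrictDerivation (powDerivation p c₁ c) (powSubalgebra p) hS)
      (D' := powDerivation p c₁ c) (powSubalgebra p).val (fun _ => rfl) (-k - 1) s
    rw [UntwistedModule.ofAssociative_mode, hmode, hcomm, Nat.cast_one, one_mul]
    exact congrArg (fun x : ℂ[X] => x • (ψ ∘ₗ r) w) hdiv.symm

end Polynomial

/-! ### Fixed points of a rotation and their modules -/

theorem mainTheorem3 (p : ℕ) (hp : 0 < p) (c₁ c : ℂ)
    (g : ℂ[X] ≃ₐ[ℂ] ℂ[X]) (hord : orderOf g = p)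
    (ξ : ℂ) (hξ : g Polynomial.X = Polynomial.C ξ * Polynomial.X) :
    let D : Derivation ℂ ℂ[X] ℂ[X] := polyDerivation
      (Polynomial.C c₁ * Polynomial.X + Polynomial.C c * Polynomial.X ^ (p + 1))
    let D' : Derivation ℂ ℂ[X] ℂ[X] := polyDerivation
      (Polynomial.C (p * c₁) * Polynomial.X + Polynomial.C (p * c) * Polynomial.X ^ 2)
    let S : Subalgebra ℂ ℂ[X] := Algebra.adjoin ℂ {(Polynomial.X : ℂ[X]) ^ p}
    -- `D` is invariant under `g`, hence `g` is an automorphism of the vertex algebra `(ℂ[t], D)`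
    (∀ a : ℂ[X], g (D a) = D (g a)) ∧
    (VertexAlgebra.ofDerivation D).IsHom (VertexAlgebra.ofDerivation D) g.toLinearMap ∧
    -- the fixed-point subalgebra is `ℂ[t^p]`
    (∀ a : ℂ[X], g a = a ↔ a ∈ S) ∧
    -- `ℂ[t^p]` is stable under `D`, and `(ℂ[t^p], D)` is a vertex subalgebra of `(ℂ[t], D)`
    ∃ hS : ∀ a ∈ S, D a ∈ S,
      (VertexAlgebra.ofDerivation (restrictDerivation D S hS)).IsHom
        (VertexAlgebra.ofDerivation D) S.val.toLinearMap ∧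
      -- `(ℂ[t^p], D) ≅ (ℂ[t], D')` as algebras with derivations and as vertex algebras
      (∃ e : S ≃ₐ[ℂ] ℂ[X], (∀ a : S, e (restrictDerivation D S hS a) = D' (e a)) ∧
        (VertexAlgebra.ofDerivation (restrictDerivation D S hS)).IsHom
          (VertexAlgebra.ofDerivation D') e.toLinearMap) ∧
      ∀ (M : Type u) [AddCommGroup M] [Module ℂ M] [FiniteDimensional ℂ M]
        (Y : UntwistedModule (VertexAlgebra.ofDerivation (restrictDerivation D S hS)) M),
        Y.IsIndecomposable →
        -- modules not coming from the associative algebra are restrictions of twisted modules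
        (¬ ComesFromAssociative Y →
          ∃ (W : Type u) (_ : AddCommGroup W) (_ : Module ℂ W) (_ : FiniteDimensional ℂ W)
            (Z : TwistedModule (VertexAlgebra.ofDerivation D) g.toLinearMap p ξ W)
            (φ : M →ₗ[ℂ] W), Z.IsIndecomposable ∧ Function.Bijective φ ∧
              IsRestrictionHom S.val.toLinearMap Y Z φ) ∧
        -- modules coming from the associative algebra are contained in modules of the same kind
        (ComesFromAssociative Y →
          ∃ (W : Type u) (_ : AddCommGroup W) (_ : Module ℂ W) (_ : FiniteDimensional ℂ W)
            (Z : UntwistedModule (VertexAlgebra.ofDerivation D) W)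
            (φ : M →ₗ[ℂ] W), Z.IsIndecomposable ∧ ComesFromAssociative Z ∧
              Function.Injective φ ∧ IsRestrictionHom S.val.toLinearMap Y Z φ) ∧
        -- every module is contained in an untwisted or a twisted one
        ((∃ (W : Type u) (_ : AddCommGroup W) (_ : Module ℂ W) (_ : FiniteDimensional ℂ W)
            (Z : UntwistedModule (VertexAlgebra.ofDerivation D) W)
            (φ : M →ₗ[ℂ] W), Z.IsIndecomposable ∧ Function.Injective φ ∧
              IsRestrictionHom S.val.toLinearMap Y Z φ) ∨
          (∃ (W : Type u) (_ : AddCommGroup W) (_ : Module ℂ W) (_ : FiniteDimensional ℂ W)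
            (Z : TwistedModule (VertexAlgebra.ofDerivation D) g.toLinearMap p ξ W)
            (φ : M →ₗ[ℂ] W), Z.IsIndecomposable ∧ Function.Injective φ ∧
              IsRestrictionHom S.val.toLinearMap Y Z φ)) := by
  intro D D' S
  have hprim := Polynomial.isPrimitiveRoot_of_orderOf hord hξ
  have hcomm := Polynomial.rotation_powDerivation hξ hprim.pow_eq_one c₁ c
  refine ⟨hcomm, VertexAlgebra.isHom_of_commute (g : ℂ[X] →ₐ[ℂ] ℂ[X]) hcomm,
    Polynomial.rotation_eq_self_iff hp hξ hprim, Polynomial.powDerivation_mem hp c₁ c,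
    VertexAlgebra.isHom_of_commute S.val fun _ => rfl, ?_, ?_⟩
  · have he : ∀ a : S, (Polynomial.powEquiv hp).symm
        (restrictDerivation D S (Polynomial.powDerivation_mem hp c₁ c) a) =
        D' ((Polynomial.powEquiv hp).symm a) := by
      intro a
      obtain ⟨q, rfl⟩ := (Polynomial.powEquiv hp).surjective a
      rw [Polynomial.restrictDerivation_powEquiv, AlgEquiv.symm_apply_apply,
        AlgEquiv.symm_apply_apply]
    exact ⟨(Polynomial.powEquiv hp).symm, he,
      VertexAlgebra.isHom_of_commute ((Polynomial.powEquiv hp).symm : S →ₐ[ℂ] ℂ[X]) he⟩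
  · intro M _ _ _ Y hY
    have htwisted : ¬ ComesFromAssociative Y → _ :=
      Polynomial.exists_twistedModule hp hξ hprim Y hY
    have hassoc : ComesFromAssociative Y → _ := Polynomial.exists_associativeModule hp Y hY
    refine ⟨fun h => ?_, hassoc, ?_⟩
    · obtain ⟨Z, hZ, hφ⟩ := htwisted h
      exact ⟨M, inferInstance, inferInstance, inferInstance, Z, LinearMap.id, hZ,
        Function.bijective_id, hφ⟩
    · by_cases h : ComesFromAssociative Y
      · obtain ⟨W, i₁, i₂, i₃, Z, φ, hZ, -, hinj, hφ⟩ := hassoc h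
        exact Or.inl ⟨W, i₁, i₂, i₃, Z, φ, hZ, hinj, hφ⟩
      · obtain ⟨Z, hZ, hφ⟩ := htwisted h
        exact Or.inr ⟨M, inferInstance, inferInstance, inferInstance, Z, LinearMap.id, hZ,
          Function.injective_id, hφ⟩
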